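/- Let $n\ge 1$, $m,L\ge 0$ be integers, and let $A\in\mathbb R^{n\times n}$, $B\in\mathbb R^{n\times(m+n)}$, $C\in\mathbb R^{m\times n}$, $D\in\mathbb R^{m\times(m+n)}$ with $\operatorname{rank}B=n$, $\operatorname{rank}D=m$ and $BD^\top=0$. Put $$\tilde A=\begin{bmatrix}A&0&\cdots&0\\ I&&&0\\ &\ddots&&\vdots\\ &&I&0\end{bmatrix},\quad \tilde B=\begin{bmatrix}B\\0\\\vdots\\0\end{bmatrix},\quad \tilde C=[\,C\;0\cdots 0\,],\quad \tilde D=D,\quad \tilde H=[\,0\cdots 0\; I\,],$$ with $L+1$ block rows in $\tilde A,\tilde B$ and $L+1$ block columns (of width $n$) in $\tilde A,\tilde C,\tilde H$. The augmented state is $\xi_t\in\mathbb R^{(L+1)n}$, and $z_t=(\xi_{t+1},y_t)$. The nominal transition law $\phi_t(\cdot\,|\,\xi_t)$ is the (degenerate Gaussian) law of $(\tilde A\xi_t+\tilde Bv,\ \tilde C\xi_t+\tilde Dv)$ with $v\sim\mathcal N(0,I_{m+n})$. Let the law of $\xi_t$ given the past observations $Y_{t-1}$ be $\tilde f_t=\mathcal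 N(\hat\xi_t,\tilde V_t)$ with $\tilde V_t>0$, and let $c_t>0$. The ambiguity set $\mathcal B_t$ consists of all nonnegative $\tilde\phi_t(z_t|\xi_t)$ having, for each $\xi_t$, the same support as $\phi_t(\cdot\,|\,\xi_t)$ (that is, the measures $\tilde\phi_t(\cdot|\xi_t)$ and $\phi_t(\cdot|\xi_t)$ are mutually absolutely continuous) and such that $$\iint\tilde\phi_t(z_t|\xi_t)\tilde f_t(\xi_t)\,dz_t\,d\xi_t=1,\qquad D(\tilde\phi_t,\phi_t):=\iint\tilde\phi_t(z_t|\xi_t)\tilde f_t(\xi_t)\ln\frac{\tilde\phi_t(z_t|\xi_t)}{\phi_t(z_t|\xi_t)}\,dz_t\,d\xi_t\le c_t$$ (no normalization for each single $\xi_t$ is imposed). Let $$J_t(\tilde\phi_t,g)=\tfrac12\iint\|\tilde H(\xi_{t+1}-g(y_t))\|^2\,\tilde\phi_t(z_t|\xi_t)\tilde f_t(\xi_t)\,dz_t\,d\xi_t ,$$ and let $\mathcal G_t$ be the set of measurable $g:\mathbb R^m\to\mathbb R^{(L+1)n}$ such that $g(y_t)$ has finite second-order moments under $\tilde\phi_t\tilde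 f_t$ for every $\tilde\phi_t\in\mathcal B_t$. Finally let $S_t=\tilde C\tilde V_t\tilde C^\top+\tilde D\tilde D^\top$, $$\tilde G_t=\tilde A\tilde V_t\tilde C^\top S_t^{-1},\qquad g_t^0(y_t)=\tilde A\hat\xi_t+\tilde G_t(y_t-\tilde C\hat\xi_t),\qquad \tilde P_{t+1}=\tilde A\tilde V_t\tilde A^\top-\tilde G_tS_t\tilde G_t^\top+\tilde B\tilde B^\top .$$ Then: 1. $g_t^0\in\mathcal G_t$, and $g_t^0$ minimizes $\sup_{\tilde\phi_t\in\mathcal B_t}J_t(\tilde\phi_t,g)$ over $g\in\mathcal G_t$. 2. $\tilde P_{t+1}>0$, and under the nominal law of $z_t$ given $Y_{t-1}$ the conditional law of $\xi_{t+1}$ given $y_t$ is $\mathcal N(g_t^0(y_t),\tilde P_{t+1})$; in particular $\tilde P_{t+1}$ is the error covariance of $\xi_{t+1}$ given $y_t$. 3. With $r(\cdot)$ the largest eigenvalue, there is exactly one $\lambda_t>r(\tilde H\tilde P_{t+1}\tilde H^\top)$ with $$\gamma(\lambda_t):=\tfrac12\Big[\operatorname{tr}\big((I-\lambda_t^{-1}\tilde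 H^\top\tilde H\tilde P_{t+1})^{-1}-I\big)+\ln\det\big(I-\lambda_t^{-1}\tilde H^\top\tilde H\tilde P_{t+1}\big)\Big]=c_t .$$ Put $\tilde V_{t+1}=(\tilde P_{t+1}^{-1}-\lambda_t^{-1}\tilde H^\top\tilde H)^{-1}$; then $\tilde V_{t+1}>0$. 4. The supremum of $J_t(\cdot,g_t^0)$ over $\mathcal B_t$ is attained. Let $\tilde\phi_t^0$ be any maximizer. Then $J_t(\tilde\phi_t^0,g_t^0)\le J_t(\tilde\phi_t^0,g)$ for all $g\in\mathcal G_t$; $\lambda_t$ is the Lagrange multiplier of the constraint, i.e. $D(\tilde\phi_t^0,\phi_t)=c_t$ and $\tilde\phi_t^0$ maximizes $J_t(\tilde\phi_t,g_t^0)+\lambda_t(c_t-D(\tilde\phi_t,\phi_t))$ over all $\tilde\phi_t$ with the same support as $\phi_t$ and total integral $1$; and the least favorable law $\tilde f_t^0(z_t|Y_{t-1})=\int\tilde\phi^0_t(z_t|\xi_t)\tilde f_t(\xi_t)\,d\xi_t$ is the non-degenerate Gaussian with mean $(\tilde A\hat\xi_t,\tilde C\hat\xi_t)$ and positive definite covariance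 $$\begin{bmatrix}I&\tilde G_t\\0&I\end{bmatrix}\begin{bmatrix}\tilde V_{t+1}&0\\0&S_t\end{bmatrix}\begin{bmatrix}I&0\\\tilde G_t^\top&I\end{bmatrix}.$$ Under it the conditional law of $\xi_{t+1}$ given $y_t$ is $\mathcal N(g_t^0(y_t),\tilde V_{t+1})$; in particular $\tilde V_{t+1}$ is the (perturbed) error covariance of $\xi_{t+1}$ given $Y_t$. -/

import Mathlib

open MeasureTheory ProbabilityTheory InformationTheory
open scoped Matrix ENNReal

noncomputable section

namespace FixedLag

/-- The data `A, B, C, D` of the nominal model `x⁺ = A x + B v`, `y = C x + D v`, with state in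
`ℝⁿ`, output in `ℝᵐ` and noise `v` in `ℝᵐ⁺ⁿ`. -/
structure Model (n m : ℕ) where
  A : Matrix (Fin n) (Fin n) ℝ
  B : Matrix (Fin n) (Fin (m + n)) ℝ
  C : Matrix (Fin m) (Fin n) ℝ
  D : Matrix (Fin m) (Fin (m + n)) ℝ

/-- Coordinates of the augmented state: `(i, a)` is coordinate `a` of block `i`, `0 ≤ i ≤ L`. -/
abbrev AugIdx (n L : ℕ) : Type := Fin (L + 1) × Fin n

/-- Coordinates of `z_t = (ξ_{t+1}, y_t)`. -/
abbrev ZIdx (n m L : ℕ) : Type := AugIdx n L ⊕ Fin m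

/-- The augmented state space `ℝ^{(L+1)n}`. -/
abbrev AugState (n L : ℕ) : Type := EuclideanSpace ℝ (AugIdx n L)

/-- The output space `ℝ^m`. -/
abbrev Output (m : ℕ) : Type := EuclideanSpace ℝ (Fin m)

/-- The space `ℝ^{(L+1)n+m}` of `z_t = (ξ_{t+1}, y_t)`. -/
abbrev ZSpace (n m L : ℕ) : Type := EuclideanSpace ℝ (ZIdx n m L)

/-- The component `ξ_{t+1}` of `z_t`. -/
def statePart {n m L : ℕ} (z : ZSpace n m L) : AugState n L :=
  WithLp.toLp 2 (fun i => z (Sum.inl i))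

/-- The component `y_t` of `z_t`. -/
def obsPart {n m L : ℕ} (z : ZSpace n m L) : Output m :=
  WithLp.toLp 2 (fun k => z (Sum.inr k))

/-- The map `ξ ↦ H̃ ξ`, i.e. the last block of the augmented state. -/
def augH (n L : ℕ) : Matrix (Fin n) (AugIdx n L) ℝ :=
  Matrix.of fun a j => if j.1 = Fin.last L ∧ j.2 = a then 1 else 0

namespace Model

variable {n m : ℕ} (M : Model n m) (L : ℕ)

/-- The first block row is `(A, 0, …, 0)`; block row `i ≥ 1` has the identity in block column
`i - 1` and zeros elsewhere. -/
def augA : Matrix (AugIdx n L) (AugIdx n L) ℝ :=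
  Matrix.of fun i j =>
    if i.1 = 0 then (if j.1 = 0 then M.A i.2 j.2 else 0)
    else if (j.1 : ℕ) + 1 = (i.1 : ℕ) ∧ i.2 = j.2 then 1 else 0

/-- `B̃ = (B; 0; …; 0)`. -/
def augB : Matrix (AugIdx n L) (Fin (m + n)) ℝ :=
  Matrix.of fun i k => if i.1 = 0 then M.B i.2 k else 0

/-- `C̃ = (C, 0, …, 0)`. -/
def augC : Matrix (Fin m) (AugIdx n L) ℝ :=
  Matrix.of fun k j => if j.1 = 0 then M.C k j.2 else 0

/-- One step of the augmented model: `z = (Ã ξ + B̃ v, C̃ ξ + D v)`. -/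
def step (ξ : AugState n L) (v : EuclideanSpace ℝ (Fin (m + n))) : ZSpace n m L :=
  WithLp.toLp 2 (Sum.elim (M.augA L *ᵥ ξ.ofLp + M.augB L *ᵥ v.ofLp)
    (M.augC L *ᵥ ξ.ofLp + M.D *ᵥ v.ofLp))

lemma measurable_step : Measurable fun p : AugState n L × EuclideanSpace ℝ (Fin (m + n)) =>
    M.step L p.1 p.2 := by
  refine Continuous.measurable ?_
  unfold step
  refine (PiLp.continuous_toLp 2 _).comp (continuous_pi fun i => ?_)
  cases i with
  | inl i =>
    simp only [Sum.elim_inl, Pi.add_apply, Matrix.mulVec, dotProduct]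
    fun_prop
  | inr k =>
    simp only [Sum.elim_inr, Pi.add_apply, Matrix.mulVec, dotProduct]
    fun_prop

/-- The nominal transition law `φ_t(· | ξ_t)` of `z_t` given `ξ_t`: the law of
`(Ã ξ_t + B̃ v, C̃ ξ_t + D v)` for a standard Gaussian vector `v`. It is a degenerate Gaussian,
carried by an affine subspace depending on `ξ_t`. -/
def transition : Kernel (AugState n L) (ZSpace n m L) where
  toFun ξ := (stdGaussian (EuclideanSpace ℝ (Fin (m + n)))).map (M.step L ξ)
  measurable' := by
    have h := (Kernel.map (Kernel.id ×ₖ Kernel.const (AugState n L)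
      (stdGaussian (EuclideanSpace ℝ (Fin (m + n)))))
      (fun p : AugState n L × EuclideanSpace ℝ (Fin (m + n)) => M.step L p.1 p.2)).measurable
    convert h using 2 with ξ
    rw [Kernel.map_apply _ (M.measurable_step L), Kernel.prod_apply, Kernel.id_apply,
      Kernel.const_apply, Measure.dirac_prod,
      Measure.map_map (M.measurable_step L) (by fun_prop)]
    rfl

lemma transition_apply (ξ : AugState n L) :
    M.transition L ξ = (stdGaussian (EuclideanSpace ℝ (Fin (m + n)))).map (M.step L ξ) := rfl

instance : IsMarkovKernel (M.transition L) where
  isProbabilityMeasure ξ := by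
    rw [transition_apply]
    exact Measure.isProbabilityMeasure_map
      ((M.measurable_step L).comp (by fun_prop : Measurable fun v => (ξ, v))).aemeasurable

/-- The innovation covariance `C̃ V C̃ᵀ + D Dᵀ`. -/
def innovCov (V : Matrix (AugIdx n L) (AugIdx n L) ℝ) : Matrix (Fin m) (Fin m) ℝ :=
  M.augC L * V * (M.augC L)ᵀ + M.D * M.Dᵀ

/-- The gain `G̃ = Ã V C̃ᵀ (C̃ V C̃ᵀ + D Dᵀ)⁻¹`. -/
def gain (V : Matrix (AugIdx n L) (AugIdx n L) ℝ) : Matrix (AugIdx n L) (Fin m) ℝ :=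
  M.augA L * V * (M.augC L)ᵀ * (M.innovCov L V)⁻¹

/-- `P̃ = Ã V Ãᵀ - G̃ (C̃ V C̃ᵀ + D Dᵀ) G̃ᵀ + B̃ B̃ᵀ`. -/
def nominalCov (V : Matrix (AugIdx n L) (AugIdx n L) ℝ) :
    Matrix (AugIdx n L) (AugIdx n L) ℝ :=
  M.augA L * V * (M.augA L)ᵀ - M.gain L V * M.innovCov L V * (M.gain L V)ᵀ
    + M.augB L * (M.augB L)ᵀ

/-- `(P̃⁻¹ - lam⁻¹ H̃ᵀ H̃)⁻¹`. -/
def perturbedCov (V : Matrix (AugIdx n L) (AugIdx n L) ℝ) (lam : ℝ) :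
    Matrix (AugIdx n L) (AugIdx n L) ℝ :=
  ((M.nominalCov L V)⁻¹ - lam⁻¹ • ((augH n L)ᵀ * augH n L))⁻¹

/-- The estimator `y ↦ Ã ξ̂ + G̃ (y - C̃ ξ̂)`. -/
def estimator (ξhat : AugState n L) (V : Matrix (AugIdx n L) (AugIdx n L) ℝ)
    (y : Output m) : AugState n L :=
  WithLp.toLp 2 (M.augA L *ᵥ ξhat.ofLp
    + M.gain L V *ᵥ (y.ofLp - M.augC L *ᵥ ξhat.ofLp))

/-- `γ(lam) = ½ [tr((I - lam⁻¹ H̃ᵀ H̃ P̃)⁻¹ - I) + ln det(I - lam⁻¹ H̃ᵀ H̃ P̃)]`. -/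
def gammaFun (V : Matrix (AugIdx n L) (AugIdx n L) ℝ) (lam : ℝ) : ℝ :=
  (1 / 2) * (((1 - lam⁻¹ • ((augH n L)ᵀ * augH n L * M.nominalCov L V))⁻¹ - 1).trace
    + Real.log (1 - lam⁻¹ • ((augH n L)ᵀ * augH n L * M.nominalCov L V)).det)

/-- The mean `(Ã ξ̂, C̃ ξ̂)` of `z_t`. -/
def zMean (ξhat : AugState n L) : ZSpace n m L :=
  WithLp.toLp 2 (Sum.elim (M.augA L *ᵥ ξhat.ofLp) (M.augC L *ᵥ ξhat.ofLp))

/-- The matrix `[I, G̃; 0, I] · diag(Ṽ_{t+1}, C̃ V C̃ᵀ + D Dᵀ) · [I, 0; G̃ᵀ, I]`. -/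
def perturbedZCov (V : Matrix (AugIdx n L) (AugIdx n L) ℝ) (lam : ℝ) :
    Matrix (ZIdx n m L) (ZIdx n m L) ℝ :=
  Matrix.fromBlocks 1 (M.gain L V) 0 1
    * Matrix.fromBlocks (M.perturbedCov L V lam) 0 0 (M.innovCov L V)
    * Matrix.fromBlocks 1 0 (M.gain L V)ᵀ 1

/-- The law of `z_t` given the past under the nominal transition law, when `ξ_t` given the past
has law `prior`. -/
def nominalLaw (prior : Measure (AugState n L)) : Measure (ZSpace n m L) :=
  (prior ⊗ₘ M.transition L).map Prod.snd

instance (prior : Measure (AugState n L)) [IsProbabilityMeasure prior] :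
    IsProbabilityMeasure (M.nominalLaw L prior) :=
  Measure.isProbabilityMeasure_map measurable_snd.aemeasurable

end Model

/-- The largest (real) eigenvalue of a square matrix. -/
def largestEigenvalue {ι : Type*} [Fintype ι] [DecidableEq ι] (P : Matrix ι ι ℝ) : ℝ :=
  sSup (spectrum ℝ P)

/-- A candidate transition density `φ̃_t(z_t | ξ_t)`, as a transition measure: for every `ξ_t` it
has the same null sets as the nominal `φ_t(· | ξ_t)` (same support), and the only normalization is
`∫∫ φ̃_t(z_t | ξ_t) f̃_t(ξ_t | Y_{t-1}) dz_t dξ_t = 1`, where `prior` is the law with density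
`f̃_t(· | Y_{t-1})`. -/
structure Perturbation {n m : ℕ} (M : Model n m) (L : ℕ) (prior : Measure (AugState n L)) where
  toKernel : Kernel (AugState n L) (ZSpace n m L)
  sFinite : IsSFiniteKernel toKernel
  ac : ∀ ξ, toKernel ξ ≪ M.transition L ξ
  ac' : ∀ ξ, M.transition L ξ ≪ toKernel ξ
  mass_one : (prior ⊗ₘ toKernel) Set.univ = 1

namespace Perturbation

variable {n m : ℕ} {M : Model n m} {L : ℕ} {prior : Measure (AugState n L)}

/-- The measure `φ̃_t(z_t | ξ_t) f̃_t(ξ_t | Y_{t-1}) dz_t dξ_t` on pairs `(ξ_t, z_t)`. -/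
def joint (φ : Perturbation M L prior) : Measure (AugState n L × ZSpace n m L) :=
  prior ⊗ₘ φ.toKernel

instance (φ : Perturbation M L prior) : IsProbabilityMeasure φ.joint := ⟨φ.mass_one⟩

/-- The law of `z_t` given the past under `φ̃_t`. -/
def zLaw (φ : Perturbation M L prior) : Measure (ZSpace n m L) := φ.joint.map Prod.snd

instance (φ : Perturbation M L prior) : IsProbabilityMeasure φ.zLaw :=
  Measure.isProbabilityMeasure_map measurable_snd.aemeasurable

/-- The conditional KL divergence `∫∫ φ̃_t f̃_t ln (φ̃_t / φ_t) dz_t dξ_t`; the ratio `φ̃_t / φ_t`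
is the density of `φ̃_t f̃_t` with respect to `φ_t f̃_t`, so this is the divergence between the
two joint laws. -/
def klCond (φ : Perturbation M L prior) : ℝ≥0∞ :=
  klDiv φ.joint (prior ⊗ₘ M.transition L)

/-- The objective `J_t(φ̃_t, g) = ½ ∫∫ ‖H̃ (ξ_{t+1} - g(y_t))‖² φ̃_t f̃_t dz_t dξ_t`. -/
def cost (φ : Perturbation M L prior) (g : Output m → AugState n L) : ℝ≥0∞ :=
  ∫⁻ p, ENNReal.ofReal ((1 / 2) *
    ‖(WithLp.toLp 2 (augH n L *ᵥ (statePart p.2 - g (obsPart p.2)).ofLp) :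
      EuclideanSpace ℝ (Fin n))‖ ^ 2) ∂φ.joint

end Perturbation

section Game

variable {n m : ℕ} (M : Model n m) (L : ℕ) (prior : Measure (AugState n L)) (c : ℝ)

/-- The ambiguity set `𝓑_t`. -/
def ambiguitySet : Set (Perturbation M L prior) := {φ | φ.klCond ≤ ENNReal.ofReal c}

/-- The class `𝓖_t` of estimators with finite second order moments under every element of the
ambiguity set. -/
def estimatorClass : Set (Output m → AugState n L) :=
  {g | Measurable g ∧ ∀ φ ∈ ambiguitySet M L prior c,
    ∫⁻ p, ENNReal.ofReal (‖g (obsPart p.2)‖ ^ 2) ∂φ.joint < ∞}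

/-- `g₀` minimizes the worst case cost over the class of estimators. -/
def SolvesMinimax (g₀ : Output m → AugState n L) : Prop :=
  g₀ ∈ estimatorClass M L prior c ∧
    ∀ g ∈ estimatorClass M L prior c,
      (⨆ φ ∈ ambiguitySet M L prior c, φ.cost g₀) ≤ ⨆ φ ∈ ambiguitySet M L prior c, φ.cost g

variable {M L prior}

/-- `φ₀` maximizes the cost of the estimator `g` over the ambiguity set. -/
def IsLeastFavorable (g : Output m → AugState n L) (φ₀ : Perturbation M L prior) : Prop :=
  φ₀ ∈ ambiguitySet M L prior c ∧ ∀ φ ∈ ambiguitySet M L prior c, φ.cost g ≤ φ₀.cost g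

/-- `lam` is a Lagrange multiplier of the constraint `klCond ≤ c` in the maximization of
`cost g`, with maximizer `φ₀`: the constraint is active and `φ₀` maximizes the Lagrangian
`cost g + lam (c - klCond)` over all perturbations. -/
def IsLagrangeMultiplier (g : Output m → AugState n L) (φ₀ : Perturbation M L prior)
    (lam : ℝ) : Prop :=
  0 ≤ lam ∧ φ₀.klCond = ENNReal.ofReal c ∧
    ∀ φ : Perturbation M L prior,
      φ.cost g + ENNReal.ofReal lam * ENNReal.ofReal c
        ≤ φ₀.cost g + ENNReal.ofReal lam * φ.klCond

end Game

/-- The conditional law of `ξ_{t+1}` given `y_t` when `z_t` has law `P`. -/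
def condState {n m L : ℕ} (P : Measure (ZSpace n m L)) [IsFiniteMeasure P] :
    Kernel (Output m) (AugState n L) :=
  condDistrib statePart obsPart P

/-- The error covariance of `ξ_{t+1}` given `y_t = y` for the estimator `g`, when `z_t` has
law `P`. -/
def errorCov {n m L : ℕ} (P : Measure (ZSpace n m L)) [IsFiniteMeasure P]
    (g : Output m → AugState n L) (y : Output m) : Matrix (AugIdx n L) (AugIdx n L) ℝ :=
  Matrix.of fun i j => ∫ ξ, (ξ i - g y i) * (ξ j - g y j) ∂(condState P y)

end FixedLag

end

/-! Cost and divergence see a perturbation only through its joint law with `ξ_t`. Since no mass is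
prescribed for a single `ξ_t`, the nominal joint law tilted by any measurable function of `z_t` with
integrable exponential is again a perturbation (`Perturbation.ofTilt`). For a fixed estimator the
inner maximization is then the Gibbs variational problem: with `f = stageCost g / lam`, one has `∫ f
dμ ≤ KL(μ, ν) + log ∫ exp f dν`, with equality only at the tilt of `ν` by `f`. If that tilt has
divergence exactly `c`, its joint law is the unique maximizing one and `lam` is a multiplier
(`IsCriticalTilt`, `joint_eq_of_isLeastFavorable`).

For the Kalman estimator the tilt is explicit. Write `z_t` in terms of the error `e = ξ_{t+1} -
g(y_t)` and the innovation: nominally these are independent centered Gaussians with covariances `P̃`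
and `S` (`nominalLaw_eq`, `map_ofErrorInnov`). The cost is a quadratic form in `e` alone, so tilting
changes `P̃` into `(P̃⁻¹ - lam⁻¹ H̃ᵀH̃)⁻¹` and leaves the innovation untouched
(`tilted_nominalLaw`). The error stays symmetric and independent of `y_t`, so the same estimator is
optimal under the tilted law (`cost_estimator_le`). This is a saddle point, which gives the minimax
property.

The multiplier comes from diagonalizing `P̃` and `H̃ᵀH̃` simultaneously: `P̃ = T Tᵀ`, `Tᵀ H̃ᵀH̃ T =
diag d`. The Gaussian integrals become one-dimensional, and the divergence of the tilt becomes
`spectralGamma d lam`, which decreases strictly from `∞` to `0` for `lam` above the largest `d i`,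
the largest eigenvalue of `H̃ P̃ H̃ᵀ`. -/

section KullbackLeibler

/-! ### Relative entropy and the Gibbs variational principle -/

variable {α : Type*} {mα : MeasurableSpace α} {μ ν : Measure α}

/-- The Fenchel-Young inequality for the pair `x log x - x`, `exp`. -/
lemma mul_le_mul_log_sub_add_exp {x : ℝ} (hx : 0 ≤ x) (t : ℝ) :
    x * t ≤ x * Real.log x - x + Real.exp t := by
  rcases hx.eq_or_lt with rfl | hx
  · simp [Real.exp_nonneg]
  · have h := Real.add_one_le_exp (t - Real.log x)
    rw [Real.exp_sub, Real.exp_log hx, le_div_iff₀ hx] at h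
    linarith

/-- Fenchel-Young with `x = dμ/dν` and `t = f` bounds the density times `f` by `ν`-integrable terms.
This transfers exponential moments of the nominal law into finite moments for every law at finite
divergence. -/
lemma integrable_of_klDiv_ne_top [IsFiniteMeasure μ] [IsFiniteMeasure ν] {f : α → ℝ}
    (hf : Measurable f) (hf0 : ∀ x, 0 ≤ f x) (hexp : Integrable (fun x => Real.exp (f x)) ν)
    (h : klDiv μ ν ≠ ∞) : Integrable f μ := by
  obtain ⟨hac, hint⟩ := klDiv_ne_top_iff.mp h
  rw [← integrable_rnDeriv_smul_iff hac]
  have h1 : Integrable (fun x => (μ.rnDeriv ν x).toReal * Real.log (μ.rnDeriv ν x).toReal) ν := by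
    have := (integrable_rnDeriv_smul_iff hac (f := llr μ ν)).mpr hint
    simpa [llr, smul_eq_mul] using this
  have h2 : Integrable (fun x => (μ.rnDeriv ν x).toReal) ν := Measure.integrable_toReal_rnDeriv
  refine Integrable.mono' ((h1.sub h2).add hexp) ?_ (ae_of_all _ fun x => ?_)
  · exact ((Measure.measurable_rnDeriv μ ν).ennreal_toReal.smul hf).aestronglyMeasurable
  · rw [smul_eq_mul, Real.norm_of_nonneg (mul_nonneg ENNReal.toReal_nonneg (hf0 x))]
    exact mul_le_mul_log_sub_add_exp ENNReal.toReal_nonneg (f x)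

/-- The Donsker-Varadhan identity. -/
lemma toReal_klDiv_tilted_right [IsProbabilityMeasure μ] [IsProbabilityMeasure ν] {f : α → ℝ}
    (hf : Integrable f μ) (hexp : Integrable (fun x => Real.exp (f x)) ν) (h : klDiv μ ν ≠ ∞) :
    klDiv μ (ν.tilted f) ≠ ∞ ∧ (klDiv μ (ν.tilted f)).toReal
      = (klDiv μ ν).toReal - ∫ x, f x ∂μ + Real.log (∫ x, Real.exp (f x) ∂ν) := by
  obtain ⟨hac, hint⟩ := klDiv_ne_top_iff.mp h
  have hac' := hac.trans (absolutelyContinuous_tilted hexp)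
  have := isProbabilityMeasure_tilted hexp
  refine ⟨klDiv_ne_top hac' (integrable_llr_tilted_right hac hf hint hexp), ?_⟩
  rw [toReal_klDiv_of_measure_eq hac (by simp), toReal_klDiv_of_measure_eq hac' (by simp),
    integral_llr_tilted_right hac hf hexp hint]

lemma integral_le_toReal_klDiv_add_log [IsProbabilityMeasure μ] [IsProbabilityMeasure ν]
    {f : α → ℝ} (hf : Integrable f μ) (hexp : Integrable (fun x => Real.exp (f x)) ν)
    (h : klDiv μ ν ≠ ∞) :
    ∫ x, f x ∂μ ≤ (klDiv μ ν).toReal + Real.log (∫ x, Real.exp (f x) ∂ν) := by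
  have h1 := (toReal_klDiv_tilted_right hf hexp h).2
  have h2 : 0 ≤ (klDiv μ (ν.tilted f)).toReal := ENNReal.toReal_nonneg
  linarith

/-- The gap in the Gibbs inequality is the divergence from `μ` to the tilted law; when it vanishes,
the two laws agree. This is what identifies an arbitrary maximizer. -/
lemma eq_tilted_of_le_integral [IsProbabilityMeasure μ] [IsProbabilityMeasure ν]
    {f : α → ℝ} (hf : Integrable f μ) (hexp : Integrable (fun x => Real.exp (f x)) ν)
    (h : klDiv μ ν ≠ ∞)
    (hle : (klDiv μ ν).toReal + Real.log (∫ x, Real.exp (f x) ∂ν) ≤ ∫ x, f x ∂μ) :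
    μ = ν.tilted f := by
  have := isProbabilityMeasure_tilted hexp
  obtain ⟨h0, h1⟩ := toReal_klDiv_tilted_right hf hexp h
  have h2 : 0 ≤ (klDiv μ (ν.tilted f)).toReal := ENNReal.toReal_nonneg
  have h3 : (klDiv μ (ν.tilted f)).toReal = 0 := by linarith
  rw [← klDiv_eq_zero_iff]
  exact ((ENNReal.toReal_eq_zero_iff _).mp h3).resolve_right h0

lemma klDiv_tilted_left_self [IsProbabilityMeasure ν] {f : α → ℝ}
    (hf : Integrable f (ν.tilted f)) (hexp : Integrable (fun x => Real.exp (f x)) ν) :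
    klDiv (ν.tilted f) ν = ENNReal.ofReal
      (∫ x, f x ∂(ν.tilted f) - Real.log (∫ x, Real.exp (f x) ∂ν)) := by
  have := isProbabilityMeasure_tilted hexp
  have hac := tilted_absolutelyContinuous ν f
  have hllr : llr (ν.tilted f) ν =ᵐ[ν.tilted f]
      fun x => f x - Real.log (∫ x, Real.exp (f x) ∂ν) :=
    hac.ae_le (log_rnDeriv_tilted_left_self hexp)
  rw [klDiv_of_ac_of_integrable hac, integral_congr_ae hllr, integral_sub hf (integrable_const _)]
  · simp
  · rw [integrable_congr hllr]
    exact hf.sub (integrable_const _)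

end KullbackLeibler

/-! ### Exponential tilting under push-forward and products -/

section Tilted

variable {α β : Type*} {mα : MeasurableSpace α} {mβ : MeasurableSpace β}

lemma tilted_map {μ : Measure α} {g : α → β} (hg : Measurable g) {f : β → ℝ} (hf : Measurable f) :
    (μ.map g).tilted f = (μ.tilted (f ∘ g)).map g := by
  ext s hs
  rw [Measure.map_apply hg hs, tilted_apply' _ _ hs, tilted_apply' _ _ (hg hs),
    setLIntegral_map hs (by fun_prop) hg,
    integral_map hg.aemeasurable (by fun_prop)]
  rfl

lemma tilted_prod_fst {μ : Measure α} {ν : Measure β} [SFinite μ] [IsProbabilityMeasure ν]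
    {f : α → ℝ} (hf : Measurable f) :
    (μ.prod ν).tilted (fun p => f p.1) = (μ.tilted f).prod ν := by
  rw [Measure.tilted, Measure.tilted, prod_withDensity_left (by fun_prop),
    integral_fun_fst (fun x => Real.exp (f x))]
  simp

end Tilted

section PiTilted

variable {ι : Type*} [Fintype ι] {α : ι → Type*} {mα : ∀ i, MeasurableSpace (α i)}

lemma tilted_pi {μ : ∀ i, Measure (α i)} [∀ i, IsProbabilityMeasure (μ i)] {f : ∀ i, α i → ℝ}
    (hexp : ∀ i, Integrable (fun x => Real.exp (f i x)) (μ i)) :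
    (Measure.pi μ).tilted (fun x => ∑ i, f i (x i)) = Measure.pi fun i => (μ i).tilted (f i) := by
  have := fun i => isProbabilityMeasure_tilted (hexp i)
  refine (Measure.pi_eq fun s hs => ?_).symm
  rw [tilted_apply_eq_ofReal_integral' _ (.univ_pi hs), Measure.restrict_pi_pi]
  simp_rw [tilted_apply_eq_ofReal_integral' _ (hs _), Real.exp_sum]
  rw [integral_div, integral_fintype_prod_eq_prod (fun i x => Real.exp (f i x)),
    integral_fintype_prod_eq_prod (fun i x => Real.exp (f i x)), ← Finset.prod_div_distrib,
    ENNReal.ofReal_prod_of_nonneg]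
  · simp_rw [integral_div]
  · exact fun i _ => div_nonneg (integral_nonneg fun _ => (Real.exp_pos _).le)
      (integral_nonneg fun _ => (Real.exp_pos _).le)

end PiTilted

/-! ### Quadratic tilts of the standard real Gaussian -/

section RealGaussian

/-- The factor `exp (d x² / 2)` lowers the precision from `1` to `1 - d`, and the prefactor is the
ratio of normalizing constants. Integrability, the partition function and the tilted law are all
read off from this identity. -/
lemma exp_sq_mul_gaussianPDFReal {d : ℝ} (hd : d < 1) (x : ℝ) :
    Real.exp (d * x ^ 2 / 2) * gaussianPDFReal 0 1 x
      = (√(1 - d))⁻¹ * gaussianPDFReal 0 (1 - d)⁻¹.toNNReal x := by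
  have h : 0 < 1 - d := by linarith
  rw [gaussianPDFReal, gaussianPDFReal, Real.coe_toNNReal _ (by positivity), mul_left_comm,
    ← Real.exp_add, ← mul_assoc, Real.sqrt_mul (by positivity) (1 - d)⁻¹, Real.sqrt_inv]
  have h' := Real.sqrt_pos.2 h
  congr 1
  · simp; field_simp
  · congr 1; simp; field_simp; ring

lemma integrable_exp_sq_gaussianReal {d : ℝ} (hd : d < 1) :
    Integrable (fun x => Real.exp (d * x ^ 2 / 2)) (gaussianReal 0 1) := by
  rw [gaussianReal_of_var_ne_zero _ one_ne_zero,
    integrable_withDensity_iff_integrable_smul' (by fun_prop)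
      (ae_of_all _ fun _ => gaussianPDF_lt_top)]
  simp_rw [toReal_gaussianPDF, smul_eq_mul, mul_comm _ (Real.exp _), exp_sq_mul_gaussianPDFReal hd]
  exact (integrable_gaussianPDFReal _ _).const_mul _

lemma toNNReal_inv_one_sub_ne_zero {d : ℝ} (hd : d < 1) : (1 - d)⁻¹.toNNReal ≠ 0 := by
  have : 0 < (1 - d)⁻¹ := inv_pos.2 (by linarith)
  simpa using this

lemma integral_exp_sq_gaussianReal {d : ℝ} (hd : d < 1) :
    ∫ x, Real.exp (d * x ^ 2 / 2) ∂(gaussianReal 0 1) = (√(1 - d))⁻¹ := by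
  rw [integral_gaussianReal_eq_integral_smul one_ne_zero]
  simp_rw [smul_eq_mul, mul_comm _ (Real.exp _), exp_sq_mul_gaussianPDFReal hd]
  rw [integral_const_mul, integral_gaussianPDFReal_eq_one _ (toNNReal_inv_one_sub_ne_zero hd),
    mul_one]

lemma tilted_sq_gaussianReal {d : ℝ} (hd : d < 1) :
    (gaussianReal 0 1).tilted (fun x => d * x ^ 2 / 2) = gaussianReal 0 (1 - d)⁻¹.toNNReal := by
  have h' : 0 < √(1 - d) := Real.sqrt_pos.2 (by linarith)
  rw [Measure.tilted, integral_exp_sq_gaussianReal hd, gaussianReal_of_var_ne_zero _ one_ne_zero,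
    gaussianReal_of_var_ne_zero _ (toNNReal_inv_one_sub_ne_zero hd),
    ← withDensity_mul _ (by fun_prop) (by fun_prop)]
  congr 1
  ext x
  rw [Pi.mul_apply, gaussianPDF, gaussianPDF, ← ENNReal.ofReal_mul (gaussianPDFReal_nonneg _ _ _)]
  congr 1
  rw [mul_div_assoc', mul_comm _ (Real.exp _), exp_sq_mul_gaussianPDFReal hd]
  field_simp

lemma integral_sq_gaussianReal (v : NNReal) : ∫ x, x ^ 2 ∂(gaussianReal 0 v) = v := by
  have h := variance_eq_integral (μ := gaussianReal 0 v) (X := id) (by fun_prop)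
  rw [variance_id_gaussianReal] at h
  simpa using h.symm

end RealGaussian

/-! ### Affine images and quadratic tilts of Gaussian vectors -/

section MultivariateGaussian

variable {ι κ κ' : Type*} [Fintype ι] [Fintype κ] [Fintype κ']

lemma measurable_toLp_mulVec (F : Matrix ι κ ℝ) :
    Measurable fun x : EuclideanSpace ℝ κ => WithLp.toLp 2 (F *ᵥ x.ofLp) := by
  refine ((PiLp.continuous_toLp 2 _).comp (Continuous.matrix_mulVec continuous_const ?_)).measurable
  exact PiLp.continuous_ofLp 2 _

lemma inner_toLp_mulVec (F : Matrix ι κ ℝ) (x : EuclideanSpace ℝ κ) (t : EuclideanSpace ℝ ι) :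
    inner ℝ (WithLp.toLp 2 (F *ᵥ x.ofLp)) t = inner ℝ x (WithLp.toLp 2 (Fᵀ *ᵥ t.ofLp)) := by
  simp only [EuclideanSpace.inner_eq_star_dotProduct, star_trivial]
  rw [Matrix.dotProduct_mulVec, ← Matrix.mulVec_transpose]

lemma dotProduct_mul_mul_transpose_mulVec (F : Matrix ι κ ℝ) (S : Matrix κ κ ℝ) (t : ι → ℝ) :
    t ⬝ᵥ (F * S * Fᵀ) *ᵥ t = (Fᵀ *ᵥ t) ⬝ᵥ S *ᵥ (Fᵀ *ᵥ t) := by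
  rw [← Matrix.mulVec_mulVec, ← Matrix.mulVec_mulVec, Matrix.dotProduct_mulVec,
    ← Matrix.mulVec_transpose]

lemma posSemidef_mul_mul_transpose {S : Matrix κ κ ℝ} (hS : S.PosSemidef) (F : Matrix ι κ ℝ) :
    (F * S * Fᵀ).PosSemidef := by
  simpa using hS.mul_mul_conjTranspose_same F

lemma measurable_quadratic (W : Matrix ι ι ℝ) :
    Measurable fun x : EuclideanSpace ℝ ι => x.ofLp ⬝ᵥ W *ᵥ x.ofLp / 2 := by
  have := PiLp.continuous_ofLp 2 (fun _ : ι => ℝ)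
  exact ((this.dotProduct (continuous_const.matrix_mulVec this)).div_const 2).measurable

lemma measurable_toLp_mulVec_pi (T : Matrix ι κ ℝ) :
    Measurable fun x : κ → ℝ => WithLp.toLp 2 (T *ᵥ x) :=
  (measurable_toLp_mulVec T).comp (PiLp.continuous_toLp 2 (fun _ : κ => ℝ)).measurable

lemma dotProduct_mulVec_of_diagonal [DecidableEq κ] {T : Matrix ι κ ℝ} {W : Matrix ι ι ℝ}
    {d : κ → ℝ} (h : Tᵀ * W * T = Matrix.diagonal d) (x : κ → ℝ) :
    (T *ᵥ x) ⬝ᵥ W *ᵥ (T *ᵥ x) / 2 = ∑ i, d i * x i ^ 2 / 2 := by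
  have h' := dotProduct_mul_mul_transpose_mulVec Tᵀ W x
  rw [Matrix.transpose_transpose, h] at h'
  rw [← h', dotProduct, Finset.sum_div]
  exact Finset.sum_congr rfl fun i _ => by rw [Matrix.mulVec_diagonal]; ring

lemma inner_toLp_mulVec_right (F : Matrix ι κ ℝ) (t : EuclideanSpace ℝ ι)
    (x : EuclideanSpace ℝ κ) :
    inner ℝ t (WithLp.toLp 2 (F *ᵥ x.ofLp)) = inner ℝ (WithLp.toLp 2 (Fᵀ *ᵥ t.ofLp)) x := by
  rw [real_inner_comm, inner_toLp_mulVec, real_inner_comm]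

variable [DecidableEq ι] [DecidableEq κ] [DecidableEq κ']

/-- The image of a product of two Gaussian measures under an affine map. -/
lemma map_prod_multivariateGaussian {μ₁ : EuclideanSpace ℝ κ} {μ₂ : EuclideanSpace ℝ κ'}
    {S₁ : Matrix κ κ ℝ} {S₂ : Matrix κ' κ' ℝ} (h₁ : S₁.PosSemidef) (h₂ : S₂.PosSemidef)
    (F₁ : Matrix ι κ ℝ) (F₂ : Matrix ι κ' ℝ) (b : EuclideanSpace ℝ ι) :
    ((multivariateGaussian μ₁ S₁).prod (multivariateGaussian μ₂ S₂)).map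
        (fun p => b + WithLp.toLp 2 (F₁ *ᵥ p.1.ofLp) + WithLp.toLp 2 (F₂ *ᵥ p.2.ofLp))
      = multivariateGaussian
          (b + WithLp.toLp 2 (F₁ *ᵥ μ₁.ofLp) + WithLp.toLp 2 (F₂ *ᵥ μ₂.ofLp))
          (F₁ * S₁ * F₁ᵀ + F₂ * S₂ * F₂ᵀ) := by
  have hm : Measurable (fun p : EuclideanSpace ℝ κ × EuclideanSpace ℝ κ' =>
      b + WithLp.toLp 2 (F₁ *ᵥ p.1.ofLp) + WithLp.toLp 2 (F₂ *ᵥ p.2.ofLp)) :=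
    (((measurable_toLp_mulVec F₁).comp measurable_fst).const_add b).add
      ((measurable_toLp_mulVec F₂).comp measurable_snd)
  have := Measure.isProbabilityMeasure_map
    (μ := (multivariateGaussian μ₁ S₁).prod (multivariateGaussian μ₂ S₂)) hm.aemeasurable
  refine Measure.ext_of_charFun (funext fun t => ?_)
  rw [charFun_multivariateGaussian
      ((posSemidef_mul_mul_transpose h₁ F₁).add (posSemidef_mul_mul_transpose h₂ F₂)),
    charFun_apply, integral_map hm.aemeasurable (by fun_prop)]
  simp_rw [inner_add_left, inner_toLp_mulVec, Complex.ofReal_add, add_mul, Complex.exp_add]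
  rw [integral_prod_mul (fun x : EuclideanSpace ℝ κ => Complex.exp ((inner ℝ b t : ℝ) * Complex.I)
        * Complex.exp ((inner ℝ x (WithLp.toLp 2 (F₁ᵀ *ᵥ t.ofLp)) : ℝ) * Complex.I))
      (fun y : EuclideanSpace ℝ κ' =>
        Complex.exp ((inner ℝ y (WithLp.toLp 2 (F₂ᵀ *ᵥ t.ofLp)) : ℝ) * Complex.I)),
    integral_const_mul, ← charFun_apply, ← charFun_apply, charFun_multivariateGaussian h₁,
    charFun_multivariateGaussian h₂, ← Complex.exp_add, ← Complex.exp_add]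
  congr 1
  rw [Matrix.add_mulVec, dotProduct_add, dotProduct_mul_mul_transpose_mulVec,
    dotProduct_mul_mul_transpose_mulVec, inner_add_right, inner_add_right,
    inner_toLp_mulVec_right, inner_toLp_mulVec_right, real_inner_comm b t]
  push_cast
  ring

/-- The image of a Gaussian measure under an affine map. -/
lemma map_multivariateGaussian {μ : EuclideanSpace ℝ κ} {S : Matrix κ κ ℝ} (hS : S.PosSemidef)
    (F : Matrix ι κ ℝ) (b : EuclideanSpace ℝ ι) :
    (multivariateGaussian μ S).map (fun x => b + WithLp.toLp 2 (F *ᵥ x.ofLp))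
      = multivariateGaussian (b + WithLp.toLp 2 (F *ᵥ μ.ofLp)) (F * S * Fᵀ) := by
  have h := map_prod_multivariateGaussian (μ₁ := μ) (μ₂ := (0 : EuclideanSpace ℝ κ)) hS
    (Matrix.PosSemidef.zero (n := κ) (R := ℝ)) F (0 : Matrix ι κ ℝ) b
  have hm : Measurable (fun x : EuclideanSpace ℝ κ => b + WithLp.toLp 2 (F *ᵥ x.ofLp)) :=
    (measurable_toLp_mulVec F).const_add b
  simp only [Matrix.zero_mulVec, WithLp.toLp_zero, add_zero, Matrix.zero_mul] at h
  rw [← h]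
  conv_lhs => rw [← (measurePreserving_fst (μ := multivariateGaussian μ S)
    (ν := multivariateGaussian (0 : EuclideanSpace ℝ κ) 0)).map_eq]
  exact Measure.map_map hm measurable_fst


lemma map_toLp_pi_gaussianReal (v : κ → NNReal) :
    (Measure.pi fun i => gaussianReal 0 (v i)).map (WithLp.toLp 2)
      = multivariateGaussian 0 (Matrix.diagonal fun i => (v i : ℝ)) := by
  apply Measure.ext_of_charFun (E := EuclideanSpace ℝ κ)
  ext t
  rw [charFun_multivariateGaussian (Matrix.PosSemidef.diagonal fun i => (v i).coe_nonneg)]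
  simp_rw [charFun_pi, charFun_gaussianReal, ← Complex.exp_sum]
  congr 1
  simp [Matrix.mulVec_diagonal, dotProduct, Finset.sum_div]
  exact Finset.sum_congr rfl fun i _ => by ring

/-- A sum of independent weighted real Gaussian variables along the columns of `T`. -/
lemma map_mulVec_pi_gaussianReal (v : κ → NNReal) (T : Matrix ι κ ℝ) :
    (Measure.pi fun i => gaussianReal 0 (v i)).map (fun x => WithLp.toLp 2 (T *ᵥ x))
      = multivariateGaussian 0 (T * Matrix.diagonal (fun i => (v i : ℝ)) * Tᵀ) := by
  have h := map_multivariateGaussian (μ := 0)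
    (Matrix.PosSemidef.diagonal fun i => (v i).coe_nonneg) T (0 : EuclideanSpace ℝ ι)
  simp only [zero_add, WithLp.ofLp_zero, Matrix.mulVec_zero, WithLp.toLp_zero] at h
  rw [← h, ← map_toLp_pi_gaussianReal, Measure.map_map (measurable_toLp_mulVec T)
    (PiLp.continuous_toLp 2 (fun _ : κ => ℝ)).measurable]
  rfl

section QuadraticTilt

variable {T : Matrix ι κ ℝ} {W : Matrix ι ι ℝ} {d : κ → ℝ}

lemma multivariateGaussian_eq_map_pi (T : Matrix ι κ ℝ) :
    multivariateGaussian 0 (T * Tᵀ)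
      = (Measure.pi fun _ => gaussianReal 0 1).map (fun x => WithLp.toLp 2 (T *ᵥ x)) := by
  simp [map_mulVec_pi_gaussianReal]

lemma integrable_exp_quadratic (h : Tᵀ * W * T = Matrix.diagonal d) (hd : ∀ i, d i < 1) :
    Integrable (fun x => Real.exp (x.ofLp ⬝ᵥ W *ᵥ x.ofLp / 2))
      (multivariateGaussian 0 (T * Tᵀ)) := by
  rw [multivariateGaussian_eq_map_pi, integrable_map_measure
    (measurable_quadratic W).exp.aestronglyMeasurable (measurable_toLp_mulVec_pi T).aemeasurable]
  simp only [Function.comp_def, dotProduct_mulVec_of_diagonal h, Real.exp_sum]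
  exact Integrable.fintype_prod fun i => integrable_exp_sq_gaussianReal (hd i)

lemma integral_exp_quadratic (h : Tᵀ * W * T = Matrix.diagonal d) (hd : ∀ i, d i < 1) :
    ∫ x, Real.exp (x.ofLp ⬝ᵥ W *ᵥ x.ofLp / 2) ∂(multivariateGaussian 0 (T * Tᵀ))
      = ∏ i, (√(1 - d i))⁻¹ := by
  rw [multivariateGaussian_eq_map_pi, integral_map (measurable_toLp_mulVec_pi T).aemeasurable
    (measurable_quadratic W).exp.aestronglyMeasurable]
  simp only [dotProduct_mulVec_of_diagonal h, Real.exp_sum]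
  rw [integral_fintype_prod_eq_prod (fun i x => Real.exp (d i * x ^ 2 / 2))]
  exact Finset.prod_congr rfl fun i _ => integral_exp_sq_gaussianReal (hd i)

/-- Pulled back along `T` to independent standard coordinates, the quadratic form separates into `∑
d i * x i ^ 2 / 2`, so the tilt acts on each coordinate by itself. -/
lemma tilted_quadratic (h : Tᵀ * W * T = Matrix.diagonal d) (hd : ∀ i, d i < 1) :
    (multivariateGaussian 0 (T * Tᵀ)).tilted (fun x => x.ofLp ⬝ᵥ W *ᵥ x.ofLp / 2)
      = multivariateGaussian 0 (T * Matrix.diagonal (fun i => (1 - d i)⁻¹) * Tᵀ) := by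
  have hv : (fun i => (1 - d i)⁻¹) = fun i => ((1 - d i)⁻¹.toNNReal : ℝ) := by
    ext i
    rw [Real.coe_toNNReal _ (inv_nonneg.2 (by linarith [hd i]))]
  rw [multivariateGaussian_eq_map_pi, tilted_map (measurable_toLp_mulVec_pi T)
    (measurable_quadratic W), hv, ← map_mulVec_pi_gaussianReal]
  simp only [Function.comp_def, dotProduct_mulVec_of_diagonal h]
  rw [tilted_pi fun i => integrable_exp_sq_gaussianReal (hd i)]
  simp_rw [fun i => tilted_sq_gaussianReal (hd i)]

lemma integrable_quadratic_and_integral (h : Tᵀ * W * T = Matrix.diagonal d)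
    (hd : ∀ i, d i < 1) :
    Integrable (fun x => x.ofLp ⬝ᵥ W *ᵥ x.ofLp / 2)
      (multivariateGaussian 0 (T * Matrix.diagonal (fun i => (1 - d i)⁻¹) * Tᵀ)) ∧
    ∫ x, x.ofLp ⬝ᵥ W *ᵥ x.ofLp / 2
      ∂(multivariateGaussian 0 (T * Matrix.diagonal (fun i => (1 - d i)⁻¹) * Tᵀ))
      = ∑ i, d i * (1 - d i)⁻¹ / 2 := by
  have hv : (fun i => (1 - d i)⁻¹) = fun i => ((1 - d i)⁻¹.toNNReal : ℝ) := by
    ext i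
    rw [Real.coe_toNNReal _ (inv_nonneg.2 (by linarith [hd i]))]
  have hint : ∀ i, Integrable (fun x : κ → ℝ => d i * x i ^ 2 / 2)
      (Measure.pi fun i => gaussianReal 0 (1 - d i)⁻¹.toNNReal) := fun i =>
    integrable_comp_eval (μ := fun i => gaussianReal 0 (1 - d i)⁻¹.toNNReal)
      (f := fun y => d i * y ^ 2 / 2)
      ((((memLp_id_gaussianReal 2).integrable_sq).const_mul (d i)).div_const 2)
  rw [hv, ← map_mulVec_pi_gaussianReal, integrable_map_measure
    (measurable_quadratic W).aestronglyMeasurable (measurable_toLp_mulVec_pi T).aemeasurable,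
    integral_map (measurable_toLp_mulVec_pi T).aemeasurable
    (measurable_quadratic W).aestronglyMeasurable]
  simp only [Function.comp_def, dotProduct_mulVec_of_diagonal h]
  refine ⟨integrable_finsetSum _ fun i _ => hint i, ?_⟩
  rw [integral_finsetSum _ fun i _ => hint i]
  refine Finset.sum_congr rfl fun i _ => ?_
  rw [integral_comp_eval (μ := fun i => gaussianReal 0 (1 - d i)⁻¹.toNNReal)
      (f := fun y => d i * y ^ 2 / 2) (by fun_prop), integral_div, integral_const_mul,
    integral_sq_gaussianReal, ← congrFun hv i]

end QuadraticTilt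

end MultivariateGaussian

/-! ### Full row rank and simultaneous diagonalization -/

section MatrixFacts

variable {ι κ : Type*} [Fintype ι] [Fintype κ]

lemma vecMul_injective_of_rank_eq_card {F : Matrix ι κ ℝ} (h : F.rank = Fintype.card ι) :
    Function.Injective F.vecMul := by
  rw [Matrix.vecMul_injective_iff, linearIndependent_iff_card_eq_finrank_span, ← h,
    Matrix.rank_eq_finrank_span_row]
  rfl

/-- Simultaneous diagonalization of a positive definite and a symmetric matrix. -/
lemma exists_mul_transpose_eq_and_diagonal [DecidableEq ι] {P : Matrix ι ι ℝ} (hP : P.PosDef)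
    {W : Matrix ι ι ℝ} (hW : W.IsHermitian) :
    ∃ (T : Matrix ι ι ℝ) (d : ι → ℝ), T * Tᵀ = P ∧ Tᵀ * W * T = Matrix.diagonal d := by
  obtain ⟨B, hB⟩ : ∃ B : Matrix ι ι ℝ, P = Bᴴ * B := by
    open scoped MatrixOrder in
    exact CStarAlgebra.nonneg_iff_eq_star_mul_self.mp hP.posSemidef.nonneg
  have hQ : (B * W * Bᵀ).IsHermitian := by
    simpa using Matrix.isHermitian_mul_mul_conjTranspose B hW
  set U : Matrix ι ι ℝ := hQ.eigenvectorUnitary.1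
  have h1 : U * star U = 1 := Unitary.mul_star_self_of_mem hQ.eigenvectorUnitary.2
  have h2 : star U * U = 1 := Unitary.star_mul_self_of_mem hQ.eigenvectorUnitary.2
  have h3 : B * W * Bᵀ = U * Matrix.diagonal hQ.eigenvalues * star U := by
    conv_lhs => rw [hQ.spectral_theorem, Unitary.conjStarAlgAut_apply]
    rfl
  have hs : star U = Uᵀ := by
    rw [Matrix.star_eq_conjTranspose, Matrix.conjTranspose_eq_transpose_of_trivial]
  -- With `P = Bᵀ B` and `U` orthogonal diagonalizing `B W Bᵀ`, inserting `U` leaves the product `T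
  -- Tᵀ` unchanged.
  refine ⟨Bᵀ * U, hQ.eigenvalues, ?_, ?_⟩
  · rw [Matrix.transpose_mul, Matrix.mul_assoc, ← Matrix.mul_assoc U, ← hs, h1, Matrix.one_mul,
      Matrix.transpose_transpose, hB, Matrix.conjTranspose_eq_transpose_of_trivial]
  · calc (Bᵀ * U)ᵀ * W * (Bᵀ * U) = Uᵀ * (B * W * Bᵀ) * U := by
          simp only [Matrix.transpose_mul, Matrix.transpose_transpose, Matrix.mul_assoc]
      _ = (star U * U) * Matrix.diagonal hQ.eigenvalues * (star U * U) := by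
          refine (congrArg (fun Z => Uᵀ * Z * U) h3).trans ?_
          rw [hs]; simp only [Matrix.mul_assoc]
      _ = _ := by rw [h2, Matrix.one_mul, Matrix.mul_one]

end MatrixFacts

/-! ### Covariance algebra of the augmented model -/

namespace FixedLag

namespace Model

variable {n m : ℕ} (M : Model n m) (L : ℕ)

lemma augB_mul_D_transpose (hBD : M.B * M.Dᵀ = 0) : M.augB L * M.Dᵀ = 0 := by
  ext i k
  have h := congrFun (congrFun hBD i.2) k
  by_cases hi : i.1 = 0
  · simpa [Matrix.mul_apply, augB, hi] using h
  · simp [Matrix.mul_apply, augB, hi]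

lemma D_mul_augB_transpose (hBD : M.B * M.Dᵀ = 0) : M.D * (M.augB L)ᵀ = 0 := by
  rw [← Matrix.transpose_transpose M.D, ← Matrix.transpose_mul, M.augB_mul_D_transpose L hBD,
    Matrix.transpose_zero]

variable {V : Matrix (AugIdx n L) (AugIdx n L) ℝ}

lemma innovCov_posDef (hD : M.D.rank = m) (hV : V.PosDef) : (M.innovCov L V).PosDef := by
  refine Matrix.PosDef.posSemidef_add (posSemidef_mul_mul_transpose hV.posSemidef _) ?_
  simpa using Matrix.PosDef.mul_conjTranspose_self M.D
    (vecMul_injective_of_rank_eq_card (by simpa using hD))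

lemma gain_mul_innovCov (hD : M.D.rank = m) (hV : V.PosDef) :
    M.gain L V * M.innovCov L V = M.augA L * V * (M.augC L)ᵀ := by
  rw [gain, Matrix.mul_assoc, Matrix.nonsing_inv_mul _
    ((Matrix.isUnit_iff_isUnit_det _).mp (M.innovCov_posDef L hD hV).isUnit), Matrix.mul_one]

lemma innovCov_mul_gain_transpose (hD : M.D.rank = m) (hV : V.PosDef) :
    M.innovCov L V * (M.gain L V)ᵀ = M.augC L * V * (M.augA L)ᵀ := by
  have hS : (M.innovCov L V)ᵀ = M.innovCov L V := by
    simpa using (M.innovCov_posDef L hD hV).isHermitian.eq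
  have hV' : Vᵀ = V := by simpa using hV.isHermitian.eq
  have h := congrArg Matrix.transpose (M.gain_mul_innovCov L hD hV)
  rw [Matrix.transpose_mul, hS] at h
  rw [h, Matrix.transpose_mul, Matrix.transpose_mul, hV', Matrix.transpose_transpose,
    Matrix.mul_assoc]

/-- The Joseph form of the nominal error covariance. -/
lemma nominalCov_eq (hD : M.D.rank = m) (hV : V.PosDef) :
    M.nominalCov L V
      = (M.augA L - M.gain L V * M.augC L) * V * (M.augA L - M.gain L V * M.augC L)ᵀ
        + M.gain L V * (M.D * M.Dᵀ) * (M.gain L V)ᵀ + M.augB L * (M.augB L)ᵀ := by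
  have h1 := M.gain_mul_innovCov L hD hV
  have h2 := M.innovCov_mul_gain_transpose L hD hV
  have h3 : M.gain L V * M.innovCov L V * (M.gain L V)ᵀ
      = M.gain L V * M.augC L * V * (M.augA L)ᵀ := by
    rw [Matrix.mul_assoc, h2]; simp only [Matrix.mul_assoc]
  have h4 : M.gain L V * (M.D * M.Dᵀ) * (M.gain L V)ᵀ
      = M.gain L V * M.innovCov L V * (M.gain L V)ᵀ
        - M.gain L V * (M.augC L * V * (M.augC L)ᵀ) * (M.gain L V)ᵀ := by
    rw [← Matrix.sub_mul, ← Matrix.mul_sub, innovCov, add_sub_cancel_left]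
  rw [h4, nominalCov, Matrix.transpose_sub, Matrix.transpose_mul, Matrix.sub_mul, Matrix.sub_mul,
    Matrix.mul_sub, Matrix.mul_sub]
  have h5 : M.augA L * V * ((M.augC L)ᵀ * (M.gain L V)ᵀ)
      = M.gain L V * M.innovCov L V * (M.gain L V)ᵀ := by rw [← Matrix.mul_assoc, h1]
  have h6 : M.gain L V * M.augC L * V * ((M.augC L)ᵀ * (M.gain L V)ᵀ)
      = M.gain L V * (M.augC L * V * (M.augC L)ᵀ) * (M.gain L V)ᵀ := by
    simp only [Matrix.mul_assoc]
  rw [h5, h6, h3]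
  abel

/-- Full row rank of `B` kills block `0` of `x`; the identities below the diagonal of `Ã` then kill
every later block. -/
lemma eq_zero_of_vecMul_augB_augA (hB : M.B.rank = n) {x : AugIdx n L → ℝ}
    (h1 : x ᵥ* M.augB L = 0) (h2 : x ᵥ* M.augA L = 0) : x = 0 := by
  have h0 : ∀ a, x (0, a) = 0 := by
    have hinj := vecMul_injective_of_rank_eq_card (F := M.B) (by simpa using hB)
    have : (fun a => x (0, a)) ᵥ* M.B = 0 ᵥ* M.B := by
      rw [Matrix.zero_vecMul, ← h1]
      ext k
      simp only [Matrix.vecMul, dotProduct, augB, Matrix.of_apply, Fintype.sum_prod_type]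
      rw [Finset.sum_eq_single (0 : Fin (L + 1))
        (fun i _ hi => Finset.sum_eq_zero fun b _ => by rw [if_neg hi, mul_zero]) (by simp)]
      simp
    exact congrFun (hinj this)
  ext ⟨i, a⟩
  induction i using Fin.cases with
  | zero => exact h0 a
  | succ i =>
    -- In column block `i` only row block `i + 1` contributes: the block `A` in row block `0` is
    -- multiplied by the vanishing block of `x`.
    have h := congrFun h2 (i.castSucc, a)
    rw [Matrix.vecMul, dotProduct, Finset.sum_eq_single (i.succ, a)] at h
    · simpa [augA] using h
    · rintro ⟨j, b⟩ - hne
      by_cases hj : j = 0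
      · simp [hj, h0]
      · have : ¬ ((i : ℕ) + 1 = j ∧ b = a) := by
          rintro ⟨hij, rfl⟩
          exact hne (by rw [Prod.mk.injEq, Fin.ext_iff]; exact ⟨hij.symm, rfl⟩)
        simp [augA, hj, this]
    · simp

/-- The Joseph form is a sum of three semidefinite terms. A vector annihilated by all three is
annihilated by `G̃ᵀ`, hence by `Ãᵀ`, and by `B̃ᵀ`, so it is zero. -/
lemma nominalCov_posDef (hB : M.B.rank = n) (hD : M.D.rank = m)
    (hV : V.PosDef) : (M.nominalCov L V).PosDef := by
  have hDD : (M.D * M.Dᵀ).PosDef := by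
    simpa using Matrix.PosDef.mul_conjTranspose_self M.D
      (vecMul_injective_of_rank_eq_card (by simpa using hD))
  rw [M.nominalCov_eq L hD hV]
  set F := M.augA L - M.gain L V * M.augC L with hF
  have p1 := posSemidef_mul_mul_transpose hV.posSemidef F
  have p2 := posSemidef_mul_mul_transpose hDD.posSemidef (M.gain L V)
  have p3 : (M.augB L * (M.augB L)ᵀ).PosSemidef := by
    simpa using Matrix.posSemidef_self_mul_conjTranspose (M.augB L)
  refine Matrix.PosDef.of_dotProduct_mulVec_pos ((p1.add p2).add p3).isHermitian fun x hx => ?_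
  have q1 := p1.dotProduct_mulVec_nonneg x
  have q2 := p2.dotProduct_mulVec_nonneg x
  have q3 := p3.dotProduct_mulVec_nonneg x
  simp only [star_trivial] at q1 q2 q3 ⊢
  rw [Matrix.add_mulVec, Matrix.add_mulVec, dotProduct_add, dotProduct_add]
  by_contra hle
  have e1 : x ⬝ᵥ (F * V * Fᵀ) *ᵥ x = 0 := by linarith
  have e2 : x ⬝ᵥ (M.gain L V * (M.D * M.Dᵀ) * (M.gain L V)ᵀ) *ᵥ x = 0 := by linarith
  have e3 : x ⬝ᵥ (M.augB L * (M.augB L)ᵀ) *ᵥ x = 0 := by linarith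
  rw [dotProduct_mul_mul_transpose_mulVec] at e1 e2
  have z1 : Fᵀ *ᵥ x = 0 := by
    by_contra hne
    exact (hV.dotProduct_mulVec_pos hne).ne' (by simpa using e1)
  have z2 : (M.gain L V)ᵀ *ᵥ x = 0 := by
    by_contra hne
    exact (hDD.dotProduct_mulVec_pos hne).ne' (by simpa using e2)
  have z3 : x ᵥ* M.augB L = 0 := by
    rw [← Matrix.mulVec_mulVec, Matrix.dotProduct_mulVec, Matrix.mulVec_transpose,
      dotProduct_self_eq_zero] at e3
    exact e3
  refine hx (M.eq_zero_of_vecMul_augB_augA L hB z3 ?_)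
  rw [hF, Matrix.transpose_sub, Matrix.sub_mulVec, Matrix.transpose_mul, ← Matrix.mulVec_mulVec, z2,
    Matrix.mulVec_zero, sub_zero, Matrix.mulVec_transpose] at z1
  exact z1

/-- The covariance of `z` when the estimation error has covariance `X` and is uncorrelated with
the innovation. -/
lemma fromBlocks_gain_mul (V X : Matrix (AugIdx n L) (AugIdx n L) ℝ) :
    Matrix.fromBlocks 1 (M.gain L V) 0 1 * Matrix.fromBlocks X 0 0 (M.innovCov L V)
        * Matrix.fromBlocks 1 0 (M.gain L V)ᵀ 1
      = Matrix.fromRows 1 (0 : Matrix (Fin m) (AugIdx n L) ℝ) * X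
          * (Matrix.fromRows 1 (0 : Matrix (Fin m) (AugIdx n L) ℝ))ᵀ
        + Matrix.fromRows (M.gain L V) 1 * M.innovCov L V
          * (Matrix.fromRows (M.gain L V) 1)ᵀ := by
  simp only [Matrix.transpose_fromRows, Matrix.fromRows_mul, Matrix.fromBlocks_multiply]
  ext (i | i) (j | j) <;> simp

/-- Block triangular factorization of the covariance of `z`, with `P̃` as Schur complement of `S`;
the noise cross terms vanish because `B Dᵀ = 0`. -/
lemma prior_noise_cov (hBD : M.B * M.Dᵀ = 0) (hD : M.D.rank = m) (hV : V.PosDef) :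
    Matrix.fromRows (M.augA L) (M.augC L) * V * (Matrix.fromRows (M.augA L) (M.augC L))ᵀ
        + Matrix.fromRows (M.augB L) M.D * (1 : Matrix (Fin (m + n)) (Fin (m + n)) ℝ)
          * (Matrix.fromRows (M.augB L) M.D)ᵀ
      = Matrix.fromBlocks 1 (M.gain L V) 0 1
          * Matrix.fromBlocks (M.nominalCov L V) 0 0 (M.innovCov L V)
          * Matrix.fromBlocks 1 0 (M.gain L V)ᵀ 1 := by
  simp only [Matrix.transpose_fromRows, Matrix.fromRows_mul, Matrix.fromBlocks_multiply]
  simp [M.gain_mul_innovCov L hD hV, M.innovCov_mul_gain_transpose L hD hV,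
    M.augB_mul_D_transpose L hBD, M.D_mul_augB_transpose L hBD]
  rw [Matrix.fromBlocks_add, nominalCov, M.gain_mul_innovCov L hD hV, innovCov, add_zero, add_zero]
  congr 1
  abel

/-- A congruence of a positive definite block diagonal matrix by an invertible unitriangular one. -/
lemma fromBlocks_gain_posDef {X : Matrix (AugIdx n L) (AugIdx n L) ℝ} (hX : X.PosDef)
    (hD : M.D.rank = m) (hV : V.PosDef) :
    (Matrix.fromBlocks 1 (M.gain L V) 0 1 * Matrix.fromBlocks X 0 0 (M.innovCov L V)
        * Matrix.fromBlocks 1 0 (M.gain L V)ᵀ 1).PosDef := by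
  have hS := M.innovCov_posDef L hD hV
  have hdiag : (Matrix.fromBlocks X 0 0 (M.innovCov L V)).PosDef := by
    refine Matrix.PosDef.of_dotProduct_mulVec_pos ?_ fun x hx => ?_
    · exact Matrix.IsHermitian.fromBlocks hX.isHermitian (by simp) hS.isHermitian
    · rw [← Sum.elim_comp_inl_inr x, Matrix.fromBlocks_mulVec]
      simp only [star_trivial, Matrix.zero_mulVec, add_zero, zero_add, Sum.elim_comp_inl,
        Sum.elim_comp_inr, sumElim_dotProduct_sumElim]
      have q1 := hX.posSemidef.dotProduct_mulVec_nonneg (x ∘ Sum.inl)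
      have q2 := hS.posSemidef.dotProduct_mulVec_nonneg (x ∘ Sum.inr)
      simp only [star_trivial] at q1 q2
      by_cases h : x ∘ Sum.inl = 0
      · have h' : x ∘ Sum.inr ≠ 0 := fun h' => hx (by
          rw [← Sum.elim_comp_inl_inr x, h, h']
          ext (i | i) <;> rfl)
        have := hS.dotProduct_mulVec_pos h'
        simp only [star_trivial] at this
        linarith
      · have := hX.dotProduct_mulVec_pos h
        simp only [star_trivial] at this
        linarith
  have hunit : IsUnit (Matrix.fromBlocks 1 (M.gain L V) 0 1 :
      Matrix (ZIdx n m L) (ZIdx n m L) ℝ) := by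
    rw [Matrix.isUnit_iff_isUnit_det, Matrix.det_fromBlocks_zero₂₁]
    simp
  have := hdiag.mul_mul_conjTranspose_same (Matrix.vecMul_injective_of_isUnit hunit)
  simpa [Matrix.fromBlocks_transpose] using this

end Model

end FixedLag

/-! ### The scalar equation for the multiplier -/

section ScalarGamma

/-- `log (t / s) < t / s - 1 ≤ t - s`, the last step using `s ≥ 1`. -/
lemma sub_one_sub_log_lt {s t : ℝ} (hs : 1 ≤ s) (hst : s < t) :
    s - 1 - Real.log s < t - 1 - Real.log t := by
  have h0 : 0 < s := by linarith
  have h1 : Real.log (t / s) < t / s - 1 :=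
    Real.log_lt_sub_one_of_pos (div_pos (by linarith) h0) (by
      rw [Ne, div_eq_one_iff_eq h0.ne']; exact hst.ne')
  rw [Real.log_div (by linarith) h0.ne'] at h1
  have h2 : t / s - 1 ≤ t - s := by
    rw [div_sub_one h0.ne']
    exact div_le_self (by linarith) hs
  linarith

/-- Follows from `log (s / 2) ≤ s / 2 - 1` and `log 2 < 1`; the linear growth gives an explicit
point where the entropy exceeds a prescribed level. -/
lemma half_sub_one_le_sub_one_sub_log {s : ℝ} (hs : 0 < s) :
    s / 2 - 1 ≤ s - 1 - Real.log s := by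
  have h1 := Real.log_le_sub_one_of_pos (half_pos hs)
  rw [Real.log_div hs.ne' two_ne_zero] at h1
  have h2 := Real.log_two_lt_d9
  linarith

variable {ι : Type*} [Fintype ι]

/-- The relative entropy of the Gaussian tilted with multiplier `lam`, in terms of the eigenvalues
of the quadratic cost. -/
noncomputable def spectralGamma (d : ι → ℝ) (lam : ℝ) : ℝ :=
  ∑ i, ((1 - d i / lam)⁻¹ - 1 + Real.log (1 - d i / lam)) / 2

variable {d : ι → ℝ}

lemma one_sub_div_pos {x lam : ℝ} (hlam : 0 < lam) (h : x < lam) : 0 < 1 - x / lam := by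
  rw [sub_pos, div_lt_one hlam]; exact h

/-- In the variable `s = (1 - x / lam)⁻¹`, which decreases in `lam` and stays at least `1`, the
expression is `s - 1 - log s`. -/
lemma strictAnti_sub_one_add_log {x lam lam' : ℝ} (hx : 0 < x) (h : x < lam) (h' : lam < lam') :
    (1 - x / lam')⁻¹ - 1 + Real.log (1 - x / lam')
      < (1 - x / lam)⁻¹ - 1 + Real.log (1 - x / lam) := by
  have hlam : 0 < lam := hx.trans h
  have h1 := one_sub_div_pos hlam h
  have h2 : x / lam' < x / lam := div_lt_div_of_pos_left hx hlam h'
  have h3 : 0 < x / lam' := div_pos hx (hlam.trans h')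
  have := sub_one_sub_log_lt (s := (1 - x / lam')⁻¹) (t := (1 - x / lam)⁻¹)
    ((one_le_inv₀ (by linarith)).2 (by linarith)) (inv_strictAnti₀ h1 (by linarith))
  simpa [Real.log_inv] using this

lemma spectralGamma_lt (hd : ∀ i, 0 ≤ d i) (hj : ∃ j, 0 < d j) {lam lam' : ℝ}
    (h : ∀ i, d i < lam) (h' : lam < lam') : spectralGamma d lam' < spectralGamma d lam := by
  obtain ⟨j, hj⟩ := hj
  refine Finset.sum_lt_sum (fun i _ => ?_) ⟨j, Finset.mem_univ _, ?_⟩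
  · rcases (hd i).eq_or_lt with h0 | h0
    · simp [← h0]
    · linarith [strictAnti_sub_one_add_log h0 (h i) h']
  · linarith [strictAnti_sub_one_add_log hj (h j) h']

lemma sub_one_add_log_nonneg {x : ℝ} (hx : 0 < x) : 0 ≤ x⁻¹ - 1 + Real.log x := by
  have := Real.log_le_sub_one_of_pos (inv_pos.2 hx)
  rw [Real.log_inv] at this
  linarith

lemma continuousOn_spectralGamma (hj : ∃ j, 0 < d j) :
    ContinuousOn (spectralGamma d) {lam | ∀ i, d i < lam} := by
  obtain ⟨j, hj⟩ := hj
  refine continuousOn_finsetSum _ fun i _ => ?_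
  have h0 : ContinuousOn (fun lam => 1 - d i / lam) {lam | ∀ i, d i < lam} :=
    continuousOn_const.sub (continuousOn_const.div continuousOn_id
      fun lam h => (hj.trans (h j)).ne')
  have h1 : ∀ lam ∈ {lam | ∀ i, d i < lam}, 1 - d i / lam ≠ 0 :=
    fun lam h => (one_sub_div_pos (hj.trans (h j)) (h i)).ne'
  exact (((h0.inv₀ h1).sub continuousOn_const).add (h0.log h1)).div_const 2

lemma tendsto_spectralGamma_atTop (d : ι → ℝ) :
    Filter.Tendsto (spectralGamma d) Filter.atTop (nhds 0) := by
  have : (0 : ℝ) = ∑ i : ι, ((1 - 0 : ℝ)⁻¹ - 1 + Real.log (1 - 0)) / 2 := by simp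
  rw [this]
  refine tendsto_finsetSum _ fun i _ => ?_
  have h0 : Filter.Tendsto (fun lam => 1 - d i / lam) Filter.atTop (nhds (1 - 0)) :=
    tendsto_const_nhds.sub (tendsto_const_nhds.div_atTop Filter.tendsto_id)
  exact (((h0.inv₀ (by simp)).sub tendsto_const_nhds).add (h0.log (by simp))).div_const 2

lemma exists_spectralGamma_eq (hj : ∃ j, 0 < d j) {c : ℝ} (hc : 0 < c) :
    ∃ lam, (∀ i, d i < lam) ∧ spectralGamma d lam = c := by
  obtain ⟨j, hj'⟩ := hj
  have : Nonempty ι := ⟨j⟩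
  obtain ⟨k, hk⟩ := Finite.exists_max d
  have hk0 : 0 < d k := hj'.trans_le (hk j)
  -- `s` solves `(s / 2 - 1) / 2 = c`, and `a` below is the point where `(1 - d k / a)⁻¹ = s`; thus
  -- the term of the largest `d k` alone is already at least `c` at `a`.
  set s := 4 * c + 2 with hs
  have hs1 : 0 < s - 1 := by linarith
  set a := d k * s / (s - 1) with ha
  have hka : d k < a := by
    rw [ha, lt_div_iff₀ hs1]; nlinarith
  have ha0 : 0 < a := hk0.trans hka
  have hlow : c ≤ spectralGamma d a := by
    have hsk : (1 - d k / a)⁻¹ = s := by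
      have h1 : s ≠ 0 := by positivity
      have h2 := hs1.ne'
      rw [ha]; field_simp; ring
    have h1 : c ≤ ((1 - d k / a)⁻¹ - 1 + Real.log (1 - d k / a)) / 2 := by
      have h2 := half_sub_one_le_sub_one_sub_log (s := (1 - d k / a)⁻¹) (by rw [hsk]; positivity)
      rw [Real.log_inv] at h2
      rw [hsk] at h2 ⊢
      linarith
    refine h1.trans (Finset.single_le_sum
      (f := fun i => ((1 - d i / a)⁻¹ - 1 + Real.log (1 - d i / a)) / 2)
      (fun i _ => ?_) (Finset.mem_univ k))
    exact div_nonneg (sub_one_add_log_nonneg (one_sub_div_pos ha0 ((hk i).trans_lt hka))) two_pos.le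
  obtain ⟨b, hb, hab⟩ := (((tendsto_spectralGamma_atTop d).eventually (gt_mem_nhds hc)).and
    (Filter.eventually_ge_atTop a)).exists
  have hsub : Set.Icc a b ⊆ {lam | ∀ i, d i < lam} :=
    fun lam h i => ((hk i).trans_lt hka).trans_le h.1
  obtain ⟨lam, hlam, h⟩ := intermediate_value_Icc' hab
    ((continuousOn_spectralGamma ⟨j, hj'⟩).mono hsub) ⟨hb.le, hlow⟩
  exact ⟨lam, hsub hlam, h⟩

lemma eq_of_spectralGamma_eq (hd : ∀ i, 0 ≤ d i) (hj : ∃ j, 0 < d j) {lam lam' : ℝ}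
    (h : ∀ i, d i < lam) (h' : ∀ i, d i < lam') (heq : spectralGamma d lam' = spectralGamma d lam) :
    lam' = lam := by
  rcases lt_trichotomy lam' lam with hlt | hlt | hlt
  · exact absurd heq (spectralGamma_lt hd hj h' hlt).ne'
  · exact hlt
  · exact absurd heq (spectralGamma_lt hd hj h hlt).ne

end ScalarGamma

/-! ### Trace, determinant, inverse and spectrum in the diagonalizing basis -/

section SpectralFormulas

variable {ι κ : Type*} [DecidableEq ι] [Fintype κ] {d : ι → ℝ}

lemma diagonal_nonneg_of_transpose_mul_self {K : Matrix κ ι ℝ}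
    (h : Kᵀ * K = Matrix.diagonal d) (i : ι) : 0 ≤ d i := by
  have h1 := congrFun (congrFun h i) i
  rw [Matrix.diagonal_apply_eq, Matrix.mul_apply] at h1
  rw [← h1]
  exact Finset.sum_nonneg fun k _ => mul_self_nonneg _

lemma exists_pos_of_transpose_mul_self [Fintype ι] {K : Matrix κ ι ℝ}
    (h : Kᵀ * K = Matrix.diagonal d) (hK : K ≠ 0) : ∃ j, 0 < d j := by
  by_contra hne
  push Not at hne
  have hd : d = 0 := funext fun i =>
    le_antisymm (hne i) (diagonal_nonneg_of_transpose_mul_self h i)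
  refine hK (Matrix.conjTranspose_mul_self_eq_zero.mp ?_)
  rw [Matrix.conjTranspose_eq_transpose_of_trivial, h, hd]
  exact Matrix.diagonal_zero

variable [Fintype ι] [DecidableEq κ] {T W : Matrix ι ι ℝ}

/-- `W T Tᵀ` is similar, through `Tᵀ`, to `Tᵀ W T`. Trace, determinant and inverse therefore reduce
to the diagonal matrix. -/
lemma one_sub_smul_eq_conj (hT : IsUnit T.det) (h : Tᵀ * W * T = Matrix.diagonal d) (lam : ℝ) :
    1 - lam⁻¹ • (W * (T * Tᵀ))
      = (Tᵀ)⁻¹ * Matrix.diagonal (fun i => 1 - d i / lam) * Tᵀ := by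
  have hT' : IsUnit (Tᵀ).det := by rwa [Matrix.det_transpose]
  have h1 : Matrix.diagonal (fun i => 1 - d i / lam) = 1 - lam⁻¹ • (Tᵀ * W * T) := by
    rw [h]
    ext i j
    by_cases hij : i = j
    · subst hij; simp [div_eq_inv_mul]
    · simp [hij]
  rw [h1, Matrix.mul_sub, Matrix.sub_mul, Matrix.mul_one, Matrix.nonsing_inv_mul _ hT',
    Matrix.mul_smul, Matrix.smul_mul]
  congr 2
  simp only [Matrix.mul_assoc]
  rw [← Matrix.mul_assoc (Tᵀ)⁻¹ Tᵀ, Matrix.nonsing_inv_mul _ hT', Matrix.one_mul]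

lemma trace_inv_add_log_det (hT : IsUnit T.det) (h : Tᵀ * W * T = Matrix.diagonal d) {lam : ℝ}
    (hlam : 0 < lam) (hd : ∀ i, d i < lam) :
    (1 / 2) * (((1 - lam⁻¹ • (W * (T * Tᵀ)))⁻¹ - 1).trace
      + Real.log (1 - lam⁻¹ • (W * (T * Tᵀ))).det) = spectralGamma d lam := by
  have hT' : IsUnit (Tᵀ).det := by rwa [Matrix.det_transpose]
  have hpos := fun i => one_sub_div_pos hlam (hd i)
  have hinv : ((Tᵀ)⁻¹ * Matrix.diagonal (fun i => 1 - d i / lam) * Tᵀ)⁻¹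
      = (Tᵀ)⁻¹ * Matrix.diagonal (fun i => (1 - d i / lam)⁻¹) * Tᵀ := by
    refine Matrix.inv_eq_right_inv ?_
    calc _ = (Tᵀ)⁻¹ * (Matrix.diagonal (fun i => 1 - d i / lam) * ((Tᵀ * (Tᵀ)⁻¹)
            * Matrix.diagonal (fun i => (1 - d i / lam)⁻¹))) * Tᵀ := by
          simp only [Matrix.mul_assoc]
      _ = 1 := by
          rw [Matrix.mul_nonsing_inv _ hT', Matrix.one_mul, Matrix.diagonal_mul_diagonal]
          simp_rw [mul_inv_cancel₀ (hpos _).ne']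
          rw [Matrix.diagonal_one, Matrix.mul_one, Matrix.nonsing_inv_mul _ hT']
  have hlog : Real.log (∏ i, (1 - d i / lam)) = ∑ i, Real.log (1 - d i / lam) :=
    Real.log_prod fun i _ => (hpos i).ne'
  rw [one_sub_smul_eq_conj hT h, hinv, Matrix.trace_sub, Matrix.trace_mul_comm, ← Matrix.mul_assoc,
    Matrix.mul_nonsing_inv _ hT', Matrix.one_mul, Matrix.det_mul_comm, ← Matrix.mul_assoc,
    Matrix.mul_nonsing_inv _ hT', Matrix.one_mul, Matrix.det_diagonal, hlog, Matrix.trace_diagonal,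
    ← Matrix.diagonal_one, Matrix.trace_diagonal, ← Finset.sum_sub_distrib,
    ← Finset.sum_add_distrib, Finset.mul_sum, spectralGamma]
  exact Finset.sum_congr rfl fun i _ => by ring

lemma inv_inv_sub_smul (hT : IsUnit T.det) (h : Tᵀ * W * T = Matrix.diagonal d) {lam : ℝ}
    (hlam : 0 < lam) (hd : ∀ i, d i < lam) :
    ((T * Tᵀ)⁻¹ - lam⁻¹ • W)⁻¹
      = T * Matrix.diagonal (fun i => (1 - d i / lam)⁻¹) * Tᵀ := by
  have hT' : IsUnit (Tᵀ).det := by rwa [Matrix.det_transpose]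
  have hpos := fun i => one_sub_div_pos hlam (hd i)
  have hP : IsUnit (T * Tᵀ).det := by rw [Matrix.det_mul]; exact hT.mul hT'
  refine Matrix.inv_eq_left_inv ?_
  have h1 : (T * Tᵀ)⁻¹ - lam⁻¹ • W
      = (1 - lam⁻¹ • (W * (T * Tᵀ))) * (T * Tᵀ)⁻¹ := by
    rw [Matrix.sub_mul, Matrix.one_mul, Matrix.smul_mul, Matrix.mul_assoc W,
      Matrix.mul_nonsing_inv _ hP, Matrix.mul_one]
  rw [h1, one_sub_smul_eq_conj hT h]
  calc _ = T * (Matrix.diagonal (fun i => (1 - d i / lam)⁻¹) * ((Tᵀ * (Tᵀ)⁻¹)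
            * Matrix.diagonal (fun i => 1 - d i / lam))) * Tᵀ * (T * Tᵀ)⁻¹ := by
          simp only [Matrix.mul_assoc]
    _ = 1 := by
          rw [Matrix.mul_nonsing_inv _ hT', Matrix.one_mul, Matrix.diagonal_mul_diagonal]
          simp_rw [inv_mul_cancel₀ (hpos _).ne']
          rw [Matrix.diagonal_one, Matrix.mul_one, Matrix.mul_nonsing_inv _ hP]

/-- `K Kᵀ` and `Kᵀ K` have the same nonzero eigenvalues, their characteristic polynomials differing
only by powers of `X`. -/
lemma largestEigenvalue_lt_iff {K : Matrix κ ι ℝ} (h : Kᵀ * K = Matrix.diagonal d) (hK : K ≠ 0)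
    (lam : ℝ) : FixedLag.largestEigenvalue (K * Kᵀ) < lam ↔ ∀ i, d i < lam := by
  have hspec : ∀ x : ℝ, x ≠ 0 → (x ∈ spectrum ℝ (K * Kᵀ) ↔ ∃ i, d i = x) := by
    intro x hx
    have h1 := congrArg (Polynomial.eval x) (Matrix.charpoly_mul_comm' K Kᵀ)
    rw [h, Polynomial.eval_mul, Polynomial.eval_mul, Polynomial.eval_pow, Polynomial.eval_pow,
      Polynomial.eval_X] at h1
    rw [Matrix.mem_spectrum_iff_isRoot_charpoly, ← Set.mem_range, ← spectrum_diagonal,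
      Matrix.mem_spectrum_iff_isRoot_charpoly, Polynomial.IsRoot.def, Polynomial.IsRoot.def]
    constructor
    · intro h2
      rw [h2, mul_zero] at h1
      exact (mul_eq_zero.mp h1.symm).resolve_left (pow_ne_zero _ hx)
    · intro h2
      rw [h2, mul_zero] at h1
      exact (mul_eq_zero.mp h1).resolve_left (pow_ne_zero _ hx)
  obtain ⟨j, hj⟩ := exists_pos_of_transpose_mul_self h hK
  have hfin : (spectrum ℝ (K * Kᵀ)).Finite := Matrix.finite_spectrum _
  have hmem : d j ∈ spectrum ℝ (K * Kᵀ) := (hspec _ hj.ne').2 ⟨j, rfl⟩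
  rw [FixedLag.largestEigenvalue, hfin.csSup_lt_iff ⟨_, hmem⟩]
  constructor
  · intro hlt i
    -- A zero `d i` need not be an eigenvalue of `K Kᵀ`; it is handled by comparison with the
    -- positive `d j`.
    rcases eq_or_ne (d i) 0 with h0 | h0
    · rw [h0]; exact hj.trans (hlt _ hmem)
    · exact hlt _ ((hspec _ h0).2 ⟨i, rfl⟩)
  · intro hlt x hx
    rcases eq_or_ne x 0 with h0 | h0
    · rw [h0]; exact hj.trans (hlt j)
    · obtain ⟨i, rfl⟩ := (hspec x h0).1 hx
      exact hlt i

end SpectralFormulas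

/-! ### Error and innovation coordinates; conditional laws -/

namespace FixedLag

variable {n m L : ℕ}

lemma continuous_statePart : Continuous (statePart : ZSpace n m L → AugState n L) :=
  (PiLp.continuous_toLp 2 _).comp
    (continuous_pi fun i => PiLp.continuous_apply 2 (fun _ => ℝ) (Sum.inl i))

lemma continuous_obsPart : Continuous (obsPart : ZSpace n m L → Output m) :=
  (PiLp.continuous_toLp 2 _).comp
    (continuous_pi fun i => PiLp.continuous_apply 2 (fun _ => ℝ) (Sum.inr i))

lemma measurable_statePart : Measurable (statePart : ZSpace n m L → AugState n L) :=
  continuous_statePart.measurable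

lemma measurable_obsPart : Measurable (obsPart : ZSpace n m L → Output m) :=
  continuous_obsPart.measurable

/-- The cost `½ ‖H̃ (ξ_{t+1} - g(y_t))‖²` as a function of `z_t`. -/
noncomputable def stageCost (g : Output m → AugState n L) (z : ZSpace n m L) : ℝ :=
  (1 / 2) * ‖(WithLp.toLp 2 (augH n L *ᵥ (statePart z - g (obsPart z)).ofLp) :
    EuclideanSpace ℝ (Fin n))‖ ^ 2

lemma stageCost_nonneg (g : Output m → AugState n L) (z : ZSpace n m L) : 0 ≤ stageCost g z := by
  unfold stageCost; positivity

lemma measurable_stageCost {g : Output m → AugState n L} (hg : Measurable g) :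
    Measurable (stageCost g) :=
  ((((measurable_toLp_mulVec (augH n L)).comp
    (measurable_statePart.sub (hg.comp measurable_obsPart))).norm).pow_const 2).const_mul _

lemma norm_sq_augH_mulVec (x : AugState n L) :
    (1 / 2) * ‖(WithLp.toLp 2 (augH n L *ᵥ x.ofLp) : EuclideanSpace ℝ (Fin n))‖ ^ 2
      = x.ofLp ⬝ᵥ ((augH n L)ᵀ * augH n L) *ᵥ x.ofLp / 2 := by
  rw [EuclideanSpace.real_norm_sq_eq, ← Matrix.mulVec_mulVec, Matrix.dotProduct_mulVec,
    Matrix.vecMul_transpose, dotProduct, one_div_mul_eq_div]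
  congr 1
  exact Finset.sum_congr rfl fun i _ => by ring

namespace Model

variable (M : Model n m) (ξhat : AugState n L) {V : Matrix (AugIdx n L) (AugIdx n L) ℝ}

lemma measurable_estimator (V : Matrix (AugIdx n L) (AugIdx n L) ℝ) :
    Measurable (M.estimator L ξhat V) := by
  refine Continuous.measurable ((PiLp.continuous_toLp 2 _).comp (continuous_const.add
    (continuous_const.matrix_mulVec (Continuous.sub ?_ continuous_const))))
  exact PiLp.continuous_ofLp 2 _

/-- The value of `z` when the estimation error is `p.1` and the innovation is `p.2`. -/
noncomputable def ofErrorInnov (V : Matrix (AugIdx n L) (AugIdx n L) ℝ)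
    (p : AugState n L × Output m) : ZSpace n m L :=
  M.zMean L ξhat + WithLp.toLp 2 (Matrix.fromRows 1 0 *ᵥ p.1.ofLp)
    + WithLp.toLp 2 (Matrix.fromRows (M.gain L V) 1 *ᵥ p.2.ofLp)

lemma measurable_ofErrorInnov (V : Matrix (AugIdx n L) (AugIdx n L) ℝ) :
    Measurable (M.ofErrorInnov ξhat V) :=
  (((measurable_toLp_mulVec _).comp measurable_fst).const_add _).add
    ((measurable_toLp_mulVec _).comp measurable_snd)

lemma obsPart_ofErrorInnov (V : Matrix (AugIdx n L) (AugIdx n L) ℝ)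
    (p : AugState n L × Output m) :
    obsPart (M.ofErrorInnov ξhat V p) = WithLp.toLp 2 (M.augC L *ᵥ ξhat.ofLp) + p.2 := by
  ext k
  simp [obsPart, ofErrorInnov, zMean, Matrix.fromRows_mulVec]

lemma statePart_ofErrorInnov (V : Matrix (AugIdx n L) (AugIdx n L) ℝ)
    (p : AugState n L × Output m) :
    statePart (M.ofErrorInnov ξhat V p)
      = M.estimator L ξhat V (WithLp.toLp 2 (M.augC L *ᵥ ξhat.ofLp) + p.2) + p.1 := by
  ext i
  simp [statePart, ofErrorInnov, zMean, estimator, Matrix.fromRows_mulVec]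
  ring

/-- Stated for a general error covariance `X`, so that it serves both the nominal law (`X = P̃`) and
the least favorable one (`X = Ṽ_{t+1}`). -/
lemma map_ofErrorInnov {X : Matrix (AugIdx n L) (AugIdx n L) ℝ} (hX : X.PosSemidef)
    (hD : M.D.rank = m) (hV : V.PosDef) :
    ((multivariateGaussian 0 X).prod (multivariateGaussian 0 (M.innovCov L V))).map
        (M.ofErrorInnov ξhat V)
      = multivariateGaussian (M.zMean L ξhat)
        (Matrix.fromBlocks 1 (M.gain L V) 0 1 * Matrix.fromBlocks X 0 0 (M.innovCov L V)
          * Matrix.fromBlocks 1 0 (M.gain L V)ᵀ 1) := by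
  have h := map_prod_multivariateGaussian (μ₁ := (0 : AugState n L)) (μ₂ := (0 : Output m)) hX
    (M.innovCov_posDef L hD hV).posSemidef
    (Matrix.fromRows 1 (0 : Matrix (Fin m) (AugIdx n L) ℝ)) (Matrix.fromRows (M.gain L V) 1)
    (M.zMean L ξhat)
  rw [← M.fromBlocks_gain_mul] at h
  simp only [WithLp.ofLp_zero, Matrix.mulVec_zero, WithLp.toLp_zero, add_zero] at h
  exact h

lemma nominalLaw_eq_map_step (prior : Measure (AugState n L)) [SFinite prior] :
    M.nominalLaw L prior = (prior.prod (stdGaussian (EuclideanSpace ℝ (Fin (m + n))))).map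
      (fun p => M.step L p.1 p.2) := by
  ext s hs
  rw [nominalLaw, Measure.map_apply measurable_snd hs,
    Measure.compProd_apply (measurable_snd hs), Measure.map_apply (M.measurable_step L) hs,
    Measure.prod_apply (M.measurable_step L hs)]
  refine lintegral_congr fun ξ => ?_
  have hm : Measurable (M.step L ξ) := (M.measurable_step L).comp measurable_prodMk_left
  exact Measure.map_apply hm hs

lemma nominalLaw_eq (hBD : M.B * M.Dᵀ = 0) (hD : M.D.rank = m) (hV : V.PosDef) :
    M.nominalLaw L (multivariateGaussian ξhat V)
      = multivariateGaussian (M.zMean L ξhat)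
        (Matrix.fromBlocks 1 (M.gain L V) 0 1
          * Matrix.fromBlocks (M.nominalCov L V) 0 0 (M.innovCov L V)
          * Matrix.fromBlocks 1 0 (M.gain L V)ᵀ 1) := by
  have h := map_prod_multivariateGaussian (μ₁ := ξhat)
    (μ₂ := (0 : EuclideanSpace ℝ (Fin (m + n)))) hV.posSemidef Matrix.PosSemidef.one
    (Matrix.fromRows (M.augA L) (M.augC L)) (Matrix.fromRows (M.augB L) M.D) 0
  rw [M.prior_noise_cov L hBD hD hV, multivariateGaussian_zero_one] at h
  rw [nominalLaw_eq_map_step]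
  convert h using 2
  · ext p i
    rcases i with i | i <;> simp [step, Matrix.fromRows_mulVec]
  · ext i
    rcases i with i | i <;> simp [zMean, Matrix.fromRows_mulVec]

lemma integral_eval_multivariateGaussian {ι : Type*} [Fintype ι] [DecidableEq ι]
    (μ : EuclideanSpace ℝ ι) (S : Matrix ι ι ℝ) (i : ι) :
    ∫ x, x i ∂(multivariateGaussian μ S) = μ i := by
  have h := (EuclideanSpace.proj (𝕜 := ℝ) i).integral_comp_comm
    (IsGaussian.integrable_id (μ := multivariateGaussian μ S))
  simpa using h

/-- Given `y`, the state is the estimator at `y` plus an error independent of `y`. This yields an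
explicit disintegration, and conditional laws are almost everywhere unique. -/
lemma condState_errorCov {X : Matrix (AugIdx n L) (AugIdx n L) ℝ} (hX : X.PosSemidef)
    {P : Measure (ZSpace n m L)} [IsFiniteMeasure P]
    (hP : P = ((multivariateGaussian 0 X).prod (multivariateGaussian 0 (M.innovCov L V))).map
        (M.ofErrorInnov ξhat V)) :
    ∀ᵐ y ∂(P.map obsPart),
      condState P y = multivariateGaussian (M.estimator L ξhat V y) X ∧
      errorCov P (M.estimator L ξhat V) y = X := by
  have hest := M.measurable_estimator ξhat V
  have hz := M.measurable_ofErrorInnov ξhat V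
  have hm : Measurable fun p : Output m × AugState n L => M.estimator L ξhat V p.1 + p.2 :=
    (hest.comp measurable_fst).add measurable_snd
  have hmy : ∀ y, Measurable fun e => M.estimator L ξhat V y + e :=
    fun y => measurable_const_add _
  let κ : Kernel (Output m) (AugState n L) :=
    (Kernel.id ×ₖ Kernel.const _ (multivariateGaussian 0 X)).map
      (fun p => M.estimator L ξhat V p.1 + p.2)
  have : IsMarkovKernel κ := Kernel.IsMarkovKernel.map _ hm
  have hκ : ∀ y, κ y = (multivariateGaussian 0 X).map (fun e => M.estimator L ξhat V y + e) := by
    intro y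
    rw [Kernel.map_apply _ hm, Kernel.prod_apply, Kernel.id_apply, Kernel.const_apply,
      Measure.dirac_prod, Measure.map_map hm measurable_prodMk_left]
    rfl
  have hκ' : ∀ y, κ y = multivariateGaussian (M.estimator L ξhat V y) X := by
    intro y
    have h := map_multivariateGaussian (μ := (0 : AugState n L)) hX 1 (M.estimator L ξhat V y)
    rw [hκ]
    simpa using h
  have hobs : Measurable fun u : Output m => WithLp.toLp 2 (M.augC L *ᵥ ξhat.ofLp) + u :=
    measurable_const_add _
  have hlaw : P.map obsPart = (multivariateGaussian 0 (M.innovCov L V)).map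
      (fun u => WithLp.toLp 2 (M.augC L *ᵥ ξhat.ofLp) + u) := by
    rw [hP, Measure.map_map measurable_obsPart hz]
    have : obsPart ∘ M.ofErrorInnov ξhat V
        = (fun u => WithLp.toLp 2 (M.augC L *ᵥ ξhat.ofLp) + u) ∘ Prod.snd :=
      funext fun p => M.obsPart_ofErrorInnov ξhat V p
    rw [this, ← Measure.map_map hobs measurable_snd, measurePreserving_snd.map_eq]
  have hpair : P.map (fun z => (obsPart z, statePart z)) = P.map obsPart ⊗ₘ κ := by
    ext s hs
    rw [Measure.compProd_apply hs, hlaw, lintegral_map (Kernel.measurable_kernel_prodMk_left hs)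
      hobs, hP, Measure.map_map (measurable_obsPart.prodMk measurable_statePart) hz,
      Measure.map_apply ((measurable_obsPart.prodMk measurable_statePart).comp hz) hs,
      Measure.prod_apply_symm ((measurable_obsPart.prodMk measurable_statePart).comp hz hs)]
    refine lintegral_congr fun u => ?_
    rw [hκ, Measure.map_apply (hmy _) (measurable_prodMk_left hs)]
    congr 1
    ext e
    simp only [Set.mem_preimage, Function.comp_apply, M.obsPart_ofErrorInnov,
      M.statePart_ofErrorInnov]
  filter_upwards [condDistrib_ae_eq_of_measure_eq_compProd_of_measurable measurable_obsPart
    measurable_statePart hpair] with y hy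
  have hy' : condState P y = multivariateGaussian (M.estimator L ξhat V y) X := hy.trans (hκ' y)
  refine ⟨hy', ?_⟩
  ext i j
  have h := covariance_eval_multivariateGaussian (μ := M.estimator L ξhat V y) hX i j
  rw [covariance] at h
  rw [errorCov, Matrix.of_apply, hy', ← h]
  simp only [integral_eval_multivariateGaussian]

end Model

end FixedLag

/-! ### Optimality and admissibility of the estimator -/

section Symmetric

lemma map_neg_multivariateGaussian {ι : Type*} [Fintype ι] [DecidableEq ι]
    {S : Matrix ι ι ℝ} (hS : S.PosSemidef) :
    (multivariateGaussian 0 S).map (fun x => -x) = multivariateGaussian 0 S := by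
  have h := map_multivariateGaussian (μ := 0) hS (-1 : Matrix ι ι ℝ) 0
  simpa [Matrix.neg_mulVec] using h

/-- Under a symmetric law, a seminorm squared is smallest in mean without translation. -/
lemma lintegral_sq_le_lintegral_sq_add {E F : Type*} [AddCommGroup E] [Module ℝ E]
    [MeasurableSpace E] [MeasurableNeg E] [NormedAddCommGroup F] [InnerProductSpace ℝ F]
    {μ : Measure E} (hμ : μ.map (fun x => -x) = μ) (K : E →ₗ[ℝ] F) (a : E)
    (hK : ∀ b, Measurable fun x => ‖K (x + b)‖) :
    ∫⁻ x, ENNReal.ofReal ((1 / 2) * ‖K x‖ ^ 2) ∂μ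
      ≤ ∫⁻ x, ENNReal.ofReal ((1 / 2) * ‖K (x + a)‖ ^ 2) ∂μ := by
  have hm : ∀ b, Measurable fun x => ENNReal.ofReal ((1 / 2) * ‖K (x + b)‖ ^ 2) :=
    fun b => (((hK b).pow_const 2).const_mul _).ennreal_ofReal
  have h0 : ∫⁻ x, ENNReal.ofReal ((1 / 2) * ‖K (x + a)‖ ^ 2) ∂μ
      = ∫⁻ x, ENNReal.ofReal ((1 / 2) * ‖K (-x + a)‖ ^ 2) ∂μ := by
    conv_lhs => rw [← hμ]
    exact lintegral_map (hm a) measurable_neg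
  have hm0 : Measurable fun x => ENNReal.ofReal ((1 / 2) * ‖K x‖ ^ 2) := by
    simpa using hm 0
  -- Averaging over `x` and `-x` and using the parallelogram law leaves an excess `‖K a‖²`. Doubling
  -- keeps everything in nonnegative integrals, so no integrability is needed.
  have h2 : 2 * ∫⁻ x, ENNReal.ofReal ((1 / 2) * ‖K x‖ ^ 2) ∂μ
      ≤ 2 * ∫⁻ x, ENNReal.ofReal ((1 / 2) * ‖K (x + a)‖ ^ 2) ∂μ := by
    rw [two_mul, two_mul]
    conv_rhs => rw [h0]
    conv_rhs => lhs; rw [← h0]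
    rw [← lintegral_add_left hm0, ← lintegral_add_left (hm a)]
    refine lintegral_mono fun x => ?_
    dsimp only
    rw [← ENNReal.ofReal_add (by positivity) (by positivity),
      ← ENNReal.ofReal_add (by positivity) (by positivity)]
    refine ENNReal.ofReal_le_ofReal ?_
    have h3 := parallelogram_law_with_norm ℝ (K a) (K x)
    have h4 : ‖K (x + a)‖ = ‖K a + K x‖ := by rw [map_add, add_comm]
    have h5 : ‖K (-x + a)‖ = ‖K a - K x‖ := by rw [map_add, map_neg, neg_add_eq_sub]
    rw [h4, h5]
    nlinarith [mul_self_nonneg ‖K a‖]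
  exact (ENNReal.mul_le_mul_iff_right two_ne_zero ENNReal.ofNat_ne_top).mp h2

end Symmetric

namespace FixedLag

variable {n m L : ℕ}

namespace Perturbation

variable {M : Model n m} {prior : Measure (AugState n L)}

lemma cost_eq_lintegral_zLaw (φ : Perturbation M L prior) {g : Output m → AugState n L}
    (hg : Measurable g) :
    φ.cost g = ∫⁻ z, ENNReal.ofReal (stageCost g z) ∂φ.zLaw := by
  rw [zLaw, lintegral_map (measurable_stageCost hg).ennreal_ofReal measurable_snd]
  rfl

lemma cost_eq_ofReal (φ : Perturbation M L prior) {g : Output m → AugState n L}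
    (hint : Integrable (fun p : AugState n L × ZSpace n m L => stageCost g p.2) φ.joint) :
    φ.cost g = ENNReal.ofReal (∫ p, stageCost g p.2 ∂φ.joint) :=
  (ofReal_integral_eq_lintegral_ofReal hint (ae_of_all _ fun p => stageCost_nonneg g p.2)).symm

end Perturbation

namespace Model

variable (M : Model n m) (ξhat : AugState n L) {V : Matrix (AugIdx n L) (AugIdx n L) ℝ}

lemma stageCost_ofErrorInnov (g : Output m → AugState n L)
    (V : Matrix (AugIdx n L) (AugIdx n L) ℝ) (p : AugState n L × Output m) :
    stageCost g (M.ofErrorInnov ξhat V p) = (1 / 2) * ‖(WithLp.toLp 2 (augH n L *ᵥ (p.1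
      + (M.estimator L ξhat V (WithLp.toLp 2 (M.augC L *ᵥ ξhat.ofLp) + p.2)
        - g (WithLp.toLp 2 (M.augC L *ᵥ ξhat.ofLp) + p.2))).ofLp) :
          EuclideanSpace ℝ (Fin n))‖ ^ 2 := by
  rw [stageCost, M.statePart_ofErrorInnov, M.obsPart_ofErrorInnov]
  congr 6
  abel

/-- For a fixed innovation, replacing the estimator by `g` translates the error by a constant
vector, and translating a symmetric law cannot lower the mean square of `H̃ e`. -/
lemma cost_estimator_le {X : Matrix (AugIdx n L) (AugIdx n L) ℝ} (hX : X.PosSemidef)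
    {prior : Measure (AugState n L)} (φ : Perturbation M L prior)
    (hφ : φ.zLaw = ((multivariateGaussian 0 X).prod
      (multivariateGaussian 0 (M.innovCov L V))).map (M.ofErrorInnov ξhat V))
    {g : Output m → AugState n L} (hg : Measurable g) :
    φ.cost (M.estimator L ξhat V) ≤ φ.cost g := by
  have hest := M.measurable_estimator ξhat V
  have hz := M.measurable_ofErrorInnov ξhat V
  rw [φ.cost_eq_lintegral_zLaw hest, φ.cost_eq_lintegral_zLaw hg, hφ,
    lintegral_map (measurable_stageCost hest).ennreal_ofReal hz,
    lintegral_map (measurable_stageCost hg).ennreal_ofReal hz,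
    lintegral_prod_symm (fun p => ENNReal.ofReal
      (stageCost (M.estimator L ξhat V) (M.ofErrorInnov ξhat V p)))
      ((measurable_stageCost hest).comp hz).ennreal_ofReal.aemeasurable,
    lintegral_prod_symm (fun p => ENNReal.ofReal (stageCost g (M.ofErrorInnov ξhat V p)))
      ((measurable_stageCost hg).comp hz).ennreal_ofReal.aemeasurable]
  refine lintegral_mono fun u => ?_
  simp only [M.stageCost_ofErrorInnov, sub_self, add_zero]
  let K : AugState n L →ₗ[ℝ] EuclideanSpace ℝ (Fin n) :=
    (WithLp.linearEquiv 2 ℝ (Fin n → ℝ)).symm.toLinearMap ∘ₗ (augH n L).mulVecLin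
      ∘ₗ (WithLp.linearEquiv 2 ℝ (AugIdx n L → ℝ)).toLinearMap
  exact lintegral_sq_le_lintegral_sq_add (map_neg_multivariateGaussian hX) K _
    fun b => ((measurable_toLp_mulVec (augH n L)).comp (measurable_add_const b)).norm

/-- The estimator is affine in the Gaussian vector `z`, hence Gaussian, and Fernique's theorem
applies. -/
lemma exists_integrable_exp_sq_estimator (hBD : M.B * M.Dᵀ = 0) (hB : M.B.rank = n)
    (hD : M.D.rank = m) (hV : V.PosDef) :
    ∃ a : ℝ, 0 < a ∧ Integrable (fun z : ZSpace n m L =>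
      Real.exp (a * ‖M.estimator L ξhat V (obsPart z)‖ ^ 2))
      (M.nominalLaw L (multivariateGaussian ξhat V)) := by
  have hpd := M.fromBlocks_gain_posDef L (M.nominalCov_posDef L hB hD hV) hD hV
  have hmap := map_multivariateGaussian (μ := M.zMean L ξhat) hpd.posSemidef
    (Matrix.fromCols 0 (M.gain L V) : Matrix (AugIdx n L) (ZIdx n m L) ℝ)
    (WithLp.toLp 2 (M.augA L *ᵥ ξhat.ofLp - M.gain L V *ᵥ M.augC L *ᵥ ξhat.ofLp))
  have hfun : (fun z : ZSpace n m L => M.estimator L ξhat V (obsPart z))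
      = fun z => WithLp.toLp 2 (M.augA L *ᵥ ξhat.ofLp - M.gain L V *ᵥ M.augC L *ᵥ ξhat.ofLp)
        + WithLp.toLp 2
          ((Matrix.fromCols 0 (M.gain L V) : Matrix (AugIdx n L) (ZIdx n m L) ℝ) *ᵥ z.ofLp) := by
    ext z i
    simp [estimator, Matrix.fromCols_mulVec, Matrix.mulVec_sub, obsPart, Function.comp_def]
    ring
  rw [← M.nominalLaw_eq ξhat hBD hD hV, ← hfun] at hmap
  have hm := (M.measurable_estimator ξhat V).comp (measurable_obsPart (n := n) (m := m) (L := L))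
  have hG : IsGaussian ((M.nominalLaw L (multivariateGaussian ξhat V)).map
      (fun z => M.estimator L ξhat V (obsPart z))) := by
    rw [hmap]; infer_instance
  obtain ⟨a, ha, hint⟩ := IsGaussian.exists_integrable_exp_sq
    ((M.nominalLaw L (multivariateGaussian ξhat V)).map
      (fun z => M.estimator L ξhat V (obsPart z)))
  exact ⟨a, ha, hint.comp_measurable hm⟩

/-- The nominal exponential moment of the squared norm becomes a second moment under every law in
the divergence ball, by `integrable_of_klDiv_ne_top`. -/
lemma estimator_mem_estimatorClass (hBD : M.B * M.Dᵀ = 0) (hB : M.B.rank = n)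
    (hD : M.D.rank = m) (hV : V.PosDef) (c : ℝ) :
    M.estimator L ξhat V ∈ estimatorClass M L (multivariateGaussian ξhat V) c := by
  refine ⟨M.measurable_estimator ξhat V, fun φ hφ => ?_⟩
  obtain ⟨a, ha, hint⟩ := M.exists_integrable_exp_sq_estimator ξhat hBD hB hD hV
  have hm : Measurable fun z : ZSpace n m L => a * ‖M.estimator L ξhat V (obsPart z)‖ ^ 2 :=
    ((((M.measurable_estimator ξhat V).comp measurable_obsPart).norm).pow_const 2).const_mul a
  have hne : klDiv φ.joint (multivariateGaussian ξhat V ⊗ₘ M.transition L) ≠ ∞ :=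
    (lt_of_le_of_lt (show φ.klCond ≤ _ from hφ) ENNReal.ofReal_lt_top).ne
  have h := integrable_of_klDiv_ne_top (hm.comp measurable_snd)
    (fun p => mul_nonneg ha.le (sq_nonneg _)) (hint.comp_measurable measurable_snd) hne
  have h' := (h.const_mul a⁻¹).lintegral_lt_top
  refine lt_of_le_of_lt (lintegral_mono fun p => ENNReal.ofReal_le_ofReal ?_) h'
  simp [inv_mul_cancel_left₀ ha.ne']

end Model

end FixedLag

/-! ### Tilting the nominal law of `z_t` by the cost -/

lemma transpose_mul_smul_mul_eq_diagonal {ι : Type*} [Fintype ι] [DecidableEq ι]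
    {T W : Matrix ι ι ℝ} {d : ι → ℝ} (h : Tᵀ * W * T = Matrix.diagonal d) (lam : ℝ) :
    Tᵀ * (lam⁻¹ • W) * T = Matrix.diagonal (fun i => d i / lam) := by
  rw [Matrix.mul_smul, Matrix.smul_mul, h]
  ext i j
  by_cases hij : i = j
  · subst hij; simp [div_eq_inv_mul]
  · simp [hij]

/-- The left side is the mean of the exponent under the tilt minus the log partition function, that
is, the divergence of the tilted Gaussian. -/
lemma sum_sub_log_prod_eq_spectralGamma {ι : Type*} [Fintype ι] {d : ι → ℝ} {lam : ℝ}
    (hlam : 0 < lam) (hd : ∀ i, d i < lam) :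
    ∑ i, d i / lam * (1 - d i / lam)⁻¹ / 2 - Real.log (∏ i, (√(1 - d i / lam))⁻¹)
      = spectralGamma d lam := by
  have hpos := fun i => one_sub_div_pos hlam (hd i)
  rw [Real.log_prod fun i _ => (inv_pos.2 (Real.sqrt_pos.2 (hpos i))).ne',
    ← Finset.sum_sub_distrib, spectralGamma]
  refine Finset.sum_congr rfl fun i _ => ?_
  rw [Real.log_inv, Real.log_sqrt (hpos i).le]
  have h1 : d i / lam * (1 - d i / lam)⁻¹ = (1 - d i / lam)⁻¹ - 1 := by
    linear_combination -mul_inv_cancel₀ (hpos i).ne'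
  rw [h1]
  ring

namespace FixedLag

variable {n m L : ℕ}

namespace Model

variable (M : Model n m) (ξhat : AugState n L) {V : Matrix (AugIdx n L) (AugIdx n L) ℝ}

lemma stageCost_estimator_ofErrorInnov (V : Matrix (AugIdx n L) (AugIdx n L) ℝ) (lam : ℝ)
    (p : AugState n L × Output m) :
    stageCost (M.estimator L ξhat V) (M.ofErrorInnov ξhat V p) / lam
      = p.1.ofLp ⬝ᵥ (lam⁻¹ • ((augH n L)ᵀ * augH n L)) *ᵥ p.1.ofLp / 2 := by
  rw [M.stageCost_ofErrorInnov, sub_self, add_zero, norm_sq_augH_mulVec, Matrix.smul_mulVec,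
    dotProduct_smul, smul_eq_mul]
  ring

section Tilt

variable {T : Matrix (AugIdx n L) (AugIdx n L) ℝ} {d : AugIdx n L → ℝ} {lam : ℝ}

lemma nominalLaw_eq_map (hBD : M.B * M.Dᵀ = 0) (hB : M.B.rank = n) (hD : M.D.rank = m)
    (hV : V.PosDef) (hTP : T * Tᵀ = M.nominalCov L V) :
    M.nominalLaw L (multivariateGaussian ξhat V)
      = ((multivariateGaussian 0 (T * Tᵀ)).prod
          (multivariateGaussian 0 (M.innovCov L V))).map (M.ofErrorInnov ξhat V) := by
  rw [M.nominalLaw_eq ξhat hBD hD hV, hTP,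
    M.map_ofErrorInnov ξhat (M.nominalCov_posDef L hB hD hV).posSemidef hD hV]

lemma exp_stageCost_nominalLaw (hBD : M.B * M.Dᵀ = 0) (hB : M.B.rank = n) (hD : M.D.rank = m)
    (hV : V.PosDef) (hTP : T * Tᵀ = M.nominalCov L V)
    (hTd : Tᵀ * ((augH n L)ᵀ * augH n L) * T = Matrix.diagonal d) (hlam : 0 < lam)
    (hd : ∀ i, d i < lam) :
    Integrable (fun z => Real.exp (stageCost (M.estimator L ξhat V) z / lam))
      (M.nominalLaw L (multivariateGaussian ξhat V)) ∧
    ∫ z, Real.exp (stageCost (M.estimator L ξhat V) z / lam)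
      ∂(M.nominalLaw L (multivariateGaussian ξhat V)) = ∏ i, (√(1 - d i / lam))⁻¹ := by
  have hz := M.measurable_ofErrorInnov ξhat V
  have hm : Measurable fun z : ZSpace n m L =>
      Real.exp (stageCost (M.estimator L ξhat V) z / lam) :=
    ((measurable_stageCost (M.measurable_estimator ξhat V)).div_const lam).exp
  have h' := transpose_mul_smul_mul_eq_diagonal hTd lam
  have hd' : ∀ i, d i / lam < 1 := fun i => (div_lt_one hlam).2 (hd i)
  rw [M.nominalLaw_eq_map ξhat hBD hB hD hV hTP,
    integrable_map_measure hm.aestronglyMeasurable hz.aemeasurable,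
    integral_map hz.aemeasurable hm.aestronglyMeasurable]
  simp only [Function.comp_def, M.stageCost_estimator_ofErrorInnov]
  refine ⟨(integrable_exp_quadratic h' hd').comp_fst _, ?_⟩
  rw [integral_fun_fst (fun x : AugState n L => Real.exp
    (x.ofLp ⬝ᵥ (lam⁻¹ • ((augH n L)ᵀ * augH n L)) *ᵥ x.ofLp / 2)), integral_exp_quadratic h' hd']
  simp

/-- In error and innovation coordinates the exponent depends on the error only, so the product
structure survives and only the first factor is tilted. -/
lemma tilted_nominalLaw (hBD : M.B * M.Dᵀ = 0) (hB : M.B.rank = n) (hD : M.D.rank = m)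
    (hV : V.PosDef) (hTP : T * Tᵀ = M.nominalCov L V)
    (hTd : Tᵀ * ((augH n L)ᵀ * augH n L) * T = Matrix.diagonal d) (hlam : 0 < lam)
    (hd : ∀ i, d i < lam) :
    (M.nominalLaw L (multivariateGaussian ξhat V)).tilted
        (fun z => stageCost (M.estimator L ξhat V) z / lam)
      = ((multivariateGaussian 0 (T * Matrix.diagonal (fun i => (1 - d i / lam)⁻¹) * Tᵀ)).prod
          (multivariateGaussian 0 (M.innovCov L V))).map (M.ofErrorInnov ξhat V) := by
  have hz := M.measurable_ofErrorInnov ξhat V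
  have hm : Measurable fun z : ZSpace n m L => stageCost (M.estimator L ξhat V) z / lam :=
    (measurable_stageCost (M.measurable_estimator ξhat V)).div_const lam
  have h' := transpose_mul_smul_mul_eq_diagonal hTd lam
  have hd' : ∀ i, d i / lam < 1 := fun i => (div_lt_one hlam).2 (hd i)
  rw [M.nominalLaw_eq_map ξhat hBD hB hD hV hTP, tilted_map hz hm]
  simp only [Function.comp_def, M.stageCost_estimator_ofErrorInnov]
  rw [tilted_prod_fst (measurable_quadratic _), tilted_quadratic h' hd']

lemma stageCost_tilted_nominalLaw (hBD : M.B * M.Dᵀ = 0) (hB : M.B.rank = n)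
    (hD : M.D.rank = m) (hV : V.PosDef) (hTP : T * Tᵀ = M.nominalCov L V)
    (hTd : Tᵀ * ((augH n L)ᵀ * augH n L) * T = Matrix.diagonal d) (hlam : 0 < lam)
    (hd : ∀ i, d i < lam) :
    Integrable (fun z => stageCost (M.estimator L ξhat V) z / lam)
      ((M.nominalLaw L (multivariateGaussian ξhat V)).tilted
        (fun z => stageCost (M.estimator L ξhat V) z / lam)) ∧
    ∫ z, stageCost (M.estimator L ξhat V) z / lam
      ∂((M.nominalLaw L (multivariateGaussian ξhat V)).tilted
        (fun z => stageCost (M.estimator L ξhat V) z / lam))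
      = ∑ i, d i / lam * (1 - d i / lam)⁻¹ / 2 := by
  have hz := M.measurable_ofErrorInnov ξhat V
  have hm : Measurable fun z : ZSpace n m L => stageCost (M.estimator L ξhat V) z / lam :=
    (measurable_stageCost (M.measurable_estimator ξhat V)).div_const lam
  have h' := transpose_mul_smul_mul_eq_diagonal hTd lam
  have hd' : ∀ i, d i / lam < 1 := fun i => (div_lt_one hlam).2 (hd i)
  obtain ⟨h1, h2⟩ := integrable_quadratic_and_integral h' hd'
  rw [M.tilted_nominalLaw ξhat hBD hB hD hV hTP hTd hlam hd,
    integrable_map_measure hm.aestronglyMeasurable hz.aemeasurable,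
    integral_map hz.aemeasurable hm.aestronglyMeasurable]
  simp only [Function.comp_def, M.stageCost_estimator_ofErrorInnov]
  refine ⟨h1.comp_fst _, ?_⟩
  rw [integral_fun_fst (fun x : AugState n L =>
    x.ofLp ⬝ᵥ (lam⁻¹ • ((augH n L)ᵀ * augH n L)) *ᵥ x.ofLp / 2), h2]
  simp

end Tilt

end Model

/-! ### Tilts as perturbations and Lagrangian duality -/

namespace Perturbation

variable {M : Model n m}

/-- The perturbation whose joint law is the nominal joint law tilted by `f (z)`. -/
noncomputable def ofTilt (M : Model n m) (prior : Measure (AugState n L))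
    [IsProbabilityMeasure prior] (f : ZSpace n m L → ℝ) (hf : Measurable f)
    (hexp : Integrable (fun z => Real.exp (f z)) (M.nominalLaw L prior)) :
    Perturbation M L prior where
  -- One global constant normalizes the total mass; the mass at an individual `ξ` may differ from
  -- `1`.
  toKernel := (M.transition L).withDensity fun _ z =>
    ENNReal.ofReal (Real.exp (f z) / ∫ x, Real.exp (f x) ∂(M.nominalLaw L prior))
  sFinite := Kernel.IsSFiniteKernel.withDensity _ fun _ _ => ENNReal.ofReal_ne_top
  ac ξ := Kernel.withDensity_absolutelyContinuous _ ξ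
  ac' ξ := by
    rw [Kernel.withDensity_apply _ (by fun_prop)]
    refine withDensity_absolutelyContinuous' (by fun_prop) (ae_of_all _ fun z => ?_)
    exact (ENNReal.ofReal_pos.2 (div_pos (Real.exp_pos _) (integral_exp_pos hexp))).ne'
  mass_one := by
    have : IsSFiniteKernel ((M.transition L).withDensity fun _ z =>
        ENNReal.ofReal (Real.exp (f z) / ∫ x, Real.exp (f x) ∂(M.nominalLaw L prior))) :=
      Kernel.IsSFiniteKernel.withDensity _ fun _ _ => ENNReal.ofReal_ne_top
    have := isProbabilityMeasure_tilted hexp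
    rw [Measure.compProd_withDensity (by fun_prop), withDensity_apply _ .univ,
      ← measure_univ (μ := (M.nominalLaw L prior).tilted f), tilted_apply' _ _ .univ]
    simp only [Measure.restrict_univ]
    rw [Model.nominalLaw, lintegral_map (by fun_prop) measurable_snd]

lemma joint_ofTilt (M : Model n m) (prior : Measure (AugState n L)) [IsProbabilityMeasure prior]
    (f : ZSpace n m L → ℝ) (hf : Measurable f)
    (hexp : Integrable (fun z => Real.exp (f z)) (M.nominalLaw L prior)) :
    (ofTilt M prior f hf hexp).joint
      = (prior ⊗ₘ M.transition L).tilted (fun p => f p.2) := by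
  have : IsSFiniteKernel ((M.transition L).withDensity fun _ z =>
      ENNReal.ofReal (Real.exp (f z) / ∫ x, Real.exp (f x) ∂(M.nominalLaw L prior))) :=
    Kernel.IsSFiniteKernel.withDensity _ fun _ _ => ENNReal.ofReal_ne_top
  rw [joint, ofTilt, Measure.compProd_withDensity (by fun_prop), Measure.tilted, Model.nominalLaw,
    integral_map measurable_snd.aemeasurable (by fun_prop)]

end Perturbation

end FixedLag

namespace FixedLag

variable {n m L : ℕ} {M : Model n m} {prior : Measure (AugState n L)}
  {g : Output m → AugState n L} {lam c : ℝ}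

namespace Perturbation

lemma cost_eq_ofReal_mul (hlam : 0 < lam) (φ : Perturbation M L prior)
    (hint : Integrable (fun p : AugState n L × ZSpace n m L => stageCost g p.2 / lam) φ.joint) :
    φ.cost g = ENNReal.ofReal (lam * ∫ p, stageCost g p.2 / lam ∂φ.joint) := by
  have h : ∀ p : AugState n L × ZSpace n m L, lam * (stageCost g p.2 / lam) = stageCost g p.2 :=
    fun p => mul_div_cancel₀ _ hlam.ne'
  rw [← integral_const_mul, φ.cost_eq_ofReal]
  · simp_rw [h]
  · simpa only [h] using hint.const_mul lam

lemma zLaw_eq_tilted (hg : Measurable g) {φ₀ : Perturbation M L prior}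
    (hφ₀ : φ₀.joint = (prior ⊗ₘ M.transition L).tilted fun p => stageCost g p.2 / lam) :
    φ₀.zLaw = (M.nominalLaw L prior).tilted fun z => stageCost g z / lam := by
  rw [zLaw, hφ₀, Model.nominalLaw,
    tilted_map measurable_snd ((measurable_stageCost hg).div_const lam)]
  rfl

variable [IsProbabilityMeasure prior]

lemma integrable_stageCost (hg : Measurable g) (hlam : 0 < lam)
    (hexp : Integrable (fun z => Real.exp (stageCost g z / lam)) (M.nominalLaw L prior))
    (φ : Perturbation M L prior) (hφ : φ.klCond ≠ ∞) :
    Integrable (fun p : AugState n L × ZSpace n m L => stageCost g p.2 / lam) φ.joint :=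
  integrable_of_klDiv_ne_top (((measurable_stageCost hg).comp measurable_snd).div_const lam)
    (fun p => div_nonneg (stageCost_nonneg g p.2) hlam.le) (hexp.comp_measurable measurable_snd) hφ

lemma integral_stageCost_le (hg : Measurable g) (hlam : 0 < lam)
    (hexp : Integrable (fun z => Real.exp (stageCost g z / lam)) (M.nominalLaw L prior))
    (φ : Perturbation M L prior) (hφ : φ.klCond ≠ ∞) :
    ∫ p, stageCost g p.2 / lam ∂φ.joint ≤ φ.klCond.toReal
      + Real.log (∫ p, Real.exp (stageCost g p.2 / lam) ∂(prior ⊗ₘ M.transition L)) :=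
  integral_le_toReal_klDiv_add_log (φ.integrable_stageCost hg hlam hexp hφ)
    (hexp.comp_measurable measurable_snd) hφ

end Perturbation

/-- Tilting the nominal law of `z_t` by `stageCost g / lam` is admissible and the tilted law has
relative entropy `c`. -/
structure IsCriticalTilt (M : Model n m) (prior : Measure (AugState n L))
    (g : Output m → AugState n L) (lam c : ℝ) : Prop where
  measurable : Measurable g
  pos : 0 < lam
  nonneg : 0 ≤ c
  integrable_exp : Integrable (fun z => Real.exp (stageCost g z / lam)) (M.nominalLaw L prior)
  integrable : Integrable (fun z => stageCost g z / lam)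
    ((M.nominalLaw L prior).tilted fun z => stageCost g z / lam)
  entropy : ∫ z, stageCost g z / lam ∂((M.nominalLaw L prior).tilted fun z => stageCost g z / lam)
    - Real.log (∫ z, Real.exp (stageCost g z / lam) ∂(M.nominalLaw L prior)) = c

namespace IsCriticalTilt

lemma integral_exp_joint (h : IsCriticalTilt M prior g lam c) :
    ∫ p, Real.exp (stageCost g p.2 / lam) ∂(prior ⊗ₘ M.transition L)
      = ∫ z, Real.exp (stageCost g z / lam) ∂(M.nominalLaw L prior) :=
  (integral_map measurable_snd.aemeasurable
    (((measurable_stageCost h.measurable).div_const lam).exp).aestronglyMeasurable).symm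

lemma integrable_tilted_joint (h : IsCriticalTilt M prior g lam c) :
    Integrable (fun p => stageCost g p.2 / lam)
      ((prior ⊗ₘ M.transition L).tilted fun p => stageCost g p.2 / lam) ∧
    ∫ p, stageCost g p.2 / lam
      ∂((prior ⊗ₘ M.transition L).tilted fun p => stageCost g p.2 / lam)
      = c + Real.log (∫ z, Real.exp (stageCost g z / lam) ∂(M.nominalLaw L prior)) := by
  have hm := (measurable_stageCost h.measurable (n := n) (m := m) (L := L)).div_const lam
  have h1 := h.integrable
  have h2 := h.entropy
  have ht : (M.nominalLaw L prior).tilted (fun z => stageCost g z / lam)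
      = ((prior ⊗ₘ M.transition L).tilted fun p => stageCost g p.2 / lam).map Prod.snd :=
    tilted_map measurable_snd hm
  rw [ht] at h1 h2
  rw [integral_map measurable_snd.aemeasurable hm.aestronglyMeasurable] at h2
  exact ⟨h1.comp_measurable measurable_snd, by linarith⟩

lemma cost_eq (h : IsCriticalTilt M prior g lam c) {φ₀ : Perturbation M L prior}
    (hφ₀ : φ₀.joint = (prior ⊗ₘ M.transition L).tilted fun p => stageCost g p.2 / lam) :
    φ₀.cost g = ENNReal.ofReal (lam *
      (c + Real.log (∫ z, Real.exp (stageCost g z / lam) ∂(M.nominalLaw L prior)))) := by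
  obtain ⟨h1, h2⟩ := h.integrable_tilted_joint
  rw [φ₀.cost_eq_ofReal_mul h.pos (by rwa [hφ₀]), hφ₀, h2]

lemma add_log_nonneg (h : IsCriticalTilt M prior g lam c) :
    0 ≤ c + Real.log (∫ z, Real.exp (stageCost g z / lam) ∂(M.nominalLaw L prior)) := by
  rw [← h.integrable_tilted_joint.2]
  exact integral_nonneg fun p => div_nonneg (stageCost_nonneg g p.2) h.pos.le

variable [IsProbabilityMeasure prior]

lemma klCond_eq (h : IsCriticalTilt M prior g lam c) {φ₀ : Perturbation M L prior}
    (hφ₀ : φ₀.joint = (prior ⊗ₘ M.transition L).tilted fun p => stageCost g p.2 / lam) :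
    φ₀.klCond = ENNReal.ofReal c := by
  obtain ⟨h1, h2⟩ := h.integrable_tilted_joint
  rw [Perturbation.klCond, hφ₀, klDiv_tilted_left_self h1
    (h.integrable_exp.comp_measurable measurable_snd), h2, h.integral_exp_joint, add_sub_cancel_right]

/-- With `Z` the partition function, the Gibbs inequality gives `cost φ ≤ lam * (KL φ + log Z)`,
while the tilt has cost exactly `lam * (c + log Z)`. At infinite divergence the claim is trivial
since `lam > 0`. -/
lemma isLagrangeMultiplier (h : IsCriticalTilt M prior g lam c) {φ₀ : Perturbation M L prior}
    (hφ₀ : φ₀.joint = (prior ⊗ₘ M.transition L).tilted fun p => stageCost g p.2 / lam) :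
    IsLagrangeMultiplier c g φ₀ lam := by
  refine ⟨h.pos.le, h.klCond_eq hφ₀, fun φ => ?_⟩
  by_cases hφ : φ.klCond = ∞
  · rw [hφ, ENNReal.mul_top (ENNReal.ofReal_pos.2 h.pos).ne', add_top]
    exact le_top
  · have h1 := φ.integral_stageCost_le h.measurable h.pos h.integrable_exp hφ
    rw [h.integral_exp_joint] at h1
    have h0 : 0 ≤ ∫ p, stageCost g p.2 / lam ∂φ.joint :=
      integral_nonneg fun p => div_nonneg (stageCost_nonneg g p.2) h.pos.le
    rw [h.cost_eq hφ₀, φ.cost_eq_ofReal_mul h.pos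
      (φ.integrable_stageCost h.measurable h.pos h.integrable_exp hφ),
      ← ENNReal.ofReal_toReal hφ, ← ENNReal.ofReal_mul h.pos.le, ← ENNReal.ofReal_mul h.pos.le,
      ← ENNReal.ofReal_add (mul_nonneg h.pos.le h0) (mul_nonneg h.pos.le h.nonneg),
      ← ENNReal.ofReal_add (mul_nonneg h.pos.le h.add_log_nonneg)
        (mul_nonneg h.pos.le ENNReal.toReal_nonneg)]
    refine ENNReal.ofReal_le_ofReal ?_
    nlinarith [mul_le_mul_of_nonneg_left h1 h.pos.le]

/-- On the ball the divergence is at most `c`, so the finite term `lam * c` cancels from the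
Lagrangian inequality. -/
lemma isLeastFavorable (h : IsCriticalTilt M prior g lam c) {φ₀ : Perturbation M L prior}
    (hφ₀ : φ₀.joint = (prior ⊗ₘ M.transition L).tilted fun p => stageCost g p.2 / lam) :
    IsLeastFavorable c g φ₀ := by
  refine ⟨(h.klCond_eq hφ₀).le, fun φ hφ => ?_⟩
  have h1 := (h.isLagrangeMultiplier hφ₀).2.2 φ
  have h2 : φ₀.cost g + ENNReal.ofReal lam * φ.klCond
      ≤ φ₀.cost g + ENNReal.ofReal lam * ENNReal.ofReal c :=
    add_le_add_right (mul_le_mul_right (show φ.klCond ≤ _ from hφ) _) _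
  exact (ENNReal.add_le_add_iff_right
    (ENNReal.mul_ne_top ENNReal.ofReal_ne_top ENNReal.ofReal_ne_top)).mp (h1.trans h2)

lemma exists_joint_eq (h : IsCriticalTilt M prior g lam c) :
    ∃ φ₀ : Perturbation M L prior,
      φ₀.joint = (prior ⊗ₘ M.transition L).tilted fun p => stageCost g p.2 / lam :=
  ⟨_, Perturbation.joint_ofTilt M prior _ ((measurable_stageCost h.measurable).div_const lam)
    h.integrable_exp⟩

/-- A maximizer has at least the cost of the tilt with divergence at most `c`, which forces equality
in the Gibbs inequality. -/
lemma joint_eq_of_isLeastFavorable (h : IsCriticalTilt M prior g lam c)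
    {φ₀ : Perturbation M L prior} (hφ₀ : IsLeastFavorable c g φ₀) :
    φ₀.joint = (prior ⊗ₘ M.transition L).tilted fun p => stageCost g p.2 / lam := by
  obtain ⟨φ₁, hφ₁⟩ := h.exists_joint_eq
  have hle : φ₀.klCond ≤ ENNReal.ofReal c := hφ₀.1
  have hne : φ₀.klCond ≠ ∞ := (hle.trans_lt ENNReal.ofReal_lt_top).ne
  have hint := φ₀.integrable_stageCost h.measurable h.pos h.integrable_exp hne
  have h0 : 0 ≤ ∫ p, stageCost g p.2 / lam ∂φ₀.joint :=
    integral_nonneg fun p => div_nonneg (stageCost_nonneg g p.2) h.pos.le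
  refine eq_tilted_of_le_integral hint (h.integrable_exp.comp_measurable measurable_snd) hne ?_
  have h1 := hφ₀.2 φ₁ (h.klCond_eq hφ₁).le
  rw [h.cost_eq hφ₁, φ₀.cost_eq_ofReal_mul h.pos hint,
    ENNReal.ofReal_le_ofReal_iff (mul_nonneg h.pos.le h0)] at h1
  have h2 := le_of_mul_le_mul_left h1 h.pos
  have h3 : φ₀.klCond.toReal ≤ c := ENNReal.toReal_le_of_le_ofReal h.nonneg hle
  rw [Perturbation.klCond] at h3
  rw [h.integral_exp_joint]
  linarith

end IsCriticalTilt

lemma augH_ne_zero (hn : 0 < n) (L : ℕ) : augH n L ≠ 0 := fun h => by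
  simpa [augH] using congrFun (congrFun h ⟨0, hn⟩) (Fin.last L, ⟨0, hn⟩)

/-- `sup J(·, g) ≤ J(φ₀, g) ≤ J(φ₀, g') ≤ sup J(·, g')`. -/
lemma solvesMinimax_of_saddle (hg : g ∈ estimatorClass M L prior c) {φ₀ : Perturbation M L prior}
    (hφ₀ : IsLeastFavorable c g φ₀)
    (hsaddle : ∀ g' ∈ estimatorClass M L prior c, φ₀.cost g ≤ φ₀.cost g') :
    SolvesMinimax M L prior c g :=
  ⟨hg, fun g' hg' => (iSup₂_le hφ₀.2).trans
    ((hsaddle g' hg').trans (le_iSup₂ (f := fun φ _ => Perturbation.cost φ g') φ₀ hφ₀.1))⟩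

end FixedLag

/-! ### Assembly of the saddle point -/

theorem theorem1 {n m L : ℕ} (hn : 0 < n) (M : FixedLag.Model n m)
    (hBD : M.B * M.Dᵀ = 0) (hB : M.B.rank = n) (hD : M.D.rank = m)
    (ξhat : FixedLag.AugState n L)
    (V : Matrix (FixedLag.AugIdx n L) (FixedLag.AugIdx n L) ℝ) (hV : V.PosDef)
    (prior : Measure (FixedLag.AugState n L)) [IsProbabilityMeasure prior]
    (hprior : prior = multivariateGaussian ξhat V)
    (c : ℝ) (hc : 0 < c) :
    FixedLag.SolvesMinimax M L prior c (M.estimator L ξhat V) ∧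
    (M.nominalCov L V).PosDef ∧
    (∀ᵐ y ∂((M.nominalLaw L prior).map FixedLag.obsPart),
      FixedLag.condState (M.nominalLaw L prior) y
          = multivariateGaussian (M.estimator L ξhat V y) (M.nominalCov L V) ∧
      FixedLag.errorCov (M.nominalLaw L prior) (M.estimator L ξhat V) y
          = M.nominalCov L V) ∧
    ∃ lam : ℝ,
      (FixedLag.largestEigenvalue
          (FixedLag.augH n L * M.nominalCov L V * (FixedLag.augH n L)ᵀ) < lam ∧
        M.gammaFun L V lam = c) ∧
      (∀ lam' : ℝ, FixedLag.largestEigenvalue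
          (FixedLag.augH n L * M.nominalCov L V * (FixedLag.augH n L)ᵀ) < lam' →
        M.gammaFun L V lam' = c → lam' = lam) ∧
      (M.perturbedCov L V lam).PosDef ∧
      (M.perturbedZCov L V lam).PosDef ∧
      (∃ φ₀ : FixedLag.Perturbation M L prior,
        FixedLag.IsLeastFavorable c (M.estimator L ξhat V) φ₀) ∧
      ∀ φ₀ : FixedLag.Perturbation M L prior,
        FixedLag.IsLeastFavorable c (M.estimator L ξhat V) φ₀ →
        (∀ g ∈ FixedLag.estimatorClass M L prior c,
          φ₀.cost (M.estimator L ξhat V) ≤ φ₀.cost g) ∧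
        FixedLag.IsLagrangeMultiplier c (M.estimator L ξhat V) φ₀ lam ∧
        φ₀.zLaw = multivariateGaussian (M.zMean L ξhat) (M.perturbedZCov L V lam) ∧
        ∀ᵐ y ∂(φ₀.zLaw.map FixedLag.obsPart),
          FixedLag.condState φ₀.zLaw y
              = multivariateGaussian (M.estimator L ξhat V y) (M.perturbedCov L V lam) ∧
          FixedLag.errorCov φ₀.zLaw (M.estimator L ξhat V) y = M.perturbedCov L V lam := by
  subst hprior
  have hP := M.nominalCov_posDef L hB hD hV
  obtain ⟨T, d, hTP, hTd⟩ := exists_mul_transpose_eq_and_diagonal hP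
    (W := (FixedLag.augH n L)ᵀ * FixedLag.augH n L)
    (by simpa using Matrix.isHermitian_conjTranspose_mul_self (FixedLag.augH n L))
  have hT : IsUnit T.det := by
    have h := (Matrix.isUnit_iff_isUnit_det _).mp hP.isUnit
    rw [← hTP, Matrix.det_mul] at h
    exact isUnit_of_mul_isUnit_left h
  -- `K = H̃ T` links both pictures: `Kᵀ K` is the diagonal matrix of the `d i`, and `K Kᵀ` is `H̃
  -- P̃ H̃ᵀ`, whose largest eigenvalue bounds the multiplier from below.
  have hK : (FixedLag.augH n L * T)ᵀ * (FixedLag.augH n L * T) = Matrix.diagonal d := by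
    rw [← hTd, Matrix.transpose_mul]
    simp only [Matrix.mul_assoc]
  have hK' : (FixedLag.augH n L * T) * (FixedLag.augH n L * T)ᵀ
      = FixedLag.augH n L * M.nominalCov L V * (FixedLag.augH n L)ᵀ := by
    rw [← hTP, Matrix.transpose_mul]
    simp only [Matrix.mul_assoc]
  have hK0 : FixedLag.augH n L * T ≠ 0 := fun h0 => FixedLag.augH_ne_zero hn L (by
    rw [← Matrix.mul_one (FixedLag.augH n L), ← Matrix.mul_nonsing_inv _ hT, ← Matrix.mul_assoc, h0,
      Matrix.zero_mul])
  have hlt := fun lam => largestEigenvalue_lt_iff hK hK0 lam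
  rw [hK'] at hlt
  have hd0 := diagonal_nonneg_of_transpose_mul_self hK
  obtain ⟨j, hj⟩ := exists_pos_of_transpose_mul_self hK hK0
  have hgamma : ∀ lam, (∀ i, d i < lam) → M.gammaFun L V lam = spectralGamma d lam := by
    intro lam hlam
    rw [← trace_inv_add_log_det hT hTd (hj.trans (hlam j)) hlam, hTP]
    rfl
  obtain ⟨lam, hdlam, hlamc⟩ := exists_spectralGamma_eq ⟨j, hj⟩ hc
  have hlam : 0 < lam := hj.trans (hdlam j)
  have hcov : M.perturbedCov L V lam
      = T * Matrix.diagonal (fun i => (1 - d i / lam)⁻¹) * Tᵀ := by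
    rw [← inv_inv_sub_smul hT hTd hlam hdlam, hTP]
    rfl
  have hpc : (M.perturbedCov L V lam).PosDef := by
    rw [hcov]
    have hdiag : (Matrix.diagonal fun i => (1 - d i / lam)⁻¹).PosDef :=
      Matrix.PosDef.diagonal fun i => inv_pos.2 (one_sub_div_pos hlam (hdlam i))
    simpa using hdiag.mul_mul_conjTranspose_same
      (Matrix.vecMul_injective_of_isUnit ((Matrix.isUnit_iff_isUnit_det _).mpr hT))
  obtain ⟨hexp, hexp'⟩ := M.exp_stageCost_nominalLaw ξhat hBD hB hD hV hTP hTd hlam hdlam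
  obtain ⟨hint, hint'⟩ := M.stageCost_tilted_nominalLaw ξhat hBD hB hD hV hTP hTd hlam hdlam
  have htilt : FixedLag.IsCriticalTilt M (multivariateGaussian ξhat V) (M.estimator L ξhat V)
      lam c := ⟨M.measurable_estimator ξhat V, hlam, hc.le, hexp, hint, by
    rw [hint', hexp', sum_sub_log_prod_eq_spectralGamma hlam hdlam, hlamc]⟩
  -- Any maximizer, not just the constructed one, has the tilted joint law, so its law of `z` is
  -- again a product in error and innovation coordinates.
  have hz : ∀ φ₀ : FixedLag.Perturbation M L (multivariateGaussian ξhat V),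
      FixedLag.IsLeastFavorable c (M.estimator L ξhat V) φ₀ →
      φ₀.zLaw = ((multivariateGaussian 0 (M.perturbedCov L V lam)).prod
        (multivariateGaussian 0 (M.innovCov L V))).map (M.ofErrorInnov ξhat V) := by
    intro φ₀ hφ₀
    rw [FixedLag.Perturbation.zLaw_eq_tilted (M.measurable_estimator ξhat V)
      (htilt.joint_eq_of_isLeastFavorable hφ₀), hcov,
      M.tilted_nominalLaw ξhat hBD hB hD hV hTP hTd hlam hdlam]
  have hsaddle : ∀ φ₀ : FixedLag.Perturbation M L (multivariateGaussian ξhat V),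
      FixedLag.IsLeastFavorable c (M.estimator L ξhat V) φ₀ →
      ∀ g ∈ FixedLag.estimatorClass M L (multivariateGaussian ξhat V) c,
        φ₀.cost (M.estimator L ξhat V) ≤ φ₀.cost g :=
    fun φ₀ hφ₀ g hg => M.cost_estimator_le ξhat hpc.posSemidef φ₀ (hz φ₀ hφ₀) hg.1
  obtain ⟨φ₁, hφ₁⟩ := htilt.exists_joint_eq
  have hlf := htilt.isLeastFavorable hφ₁
  refine ⟨FixedLag.solvesMinimax_of_saddle
      (M.estimator_mem_estimatorClass ξhat hBD hB hD hV c) hlf (hsaddle φ₁ hlf), hP,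
    M.condState_errorCov ξhat hP.posSemidef ?_, lam, ⟨(hlt lam).2 hdlam, ?_⟩, ?_, hpc,
    M.fromBlocks_gain_posDef L hpc hD hV, ⟨φ₁, hlf⟩, fun φ₀ hφ₀ => ⟨hsaddle φ₀ hφ₀,
      htilt.isLagrangeMultiplier (htilt.joint_eq_of_isLeastFavorable hφ₀), ?_,
      M.condState_errorCov ξhat hpc.posSemidef (hz φ₀ hφ₀)⟩⟩
  · rw [M.nominalLaw_eq_map ξhat hBD hB hD hV hTP, hTP]
  · rw [hgamma lam hdlam, hlamc]
  · intro lam' h1 h2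
    rw [hlt] at h1
    rw [hgamma lam' h1, ← hlamc] at h2
    exact eq_of_spectralGamma_eq hd0 ⟨j, hj⟩ hdlam h1 h2
  · rw [hz φ₀ hφ₀, M.map_ofErrorInnov ξhat hpc.posSemidef hD hV]
    rfl
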